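/- Let $(\Omega,\mathbb{P})$ be a probability space with a filtration. Let $B$ be a Brownian motion on the Lie algebra $\mathfrak{sl}(2)$ of trace-free real $2\times 2$ matrices relative to this filtration, that is, an adapted process with continuous paths, $B_0=0$, whose increments $B_t-B_s$, $s\le t$, are independent of the past up to time $s$ and centered Gaussian with covariance $t-s$ times a fixed covariance form. Let $F$ be a continuous adapted matrix-valued solution of the Stratonovich equation $$dF=F_\tau\circ dB,\qquad F_{\tau=0}=\mathrm{id},$$ where $B$ is the Brownian motion on $\mathfrak{sl}(2)$, unique in law, that is specified by the requirement that $F$ has the following properties: (i) $OFO^{-1}=F$ in law as processes, for every $O\in\mathbf{O}(2)$; (ii) the Itô and Stratonovich interpretations of the product coincide, $F_\tau\circ dB=F_\tau\,dB$; (iii) $\mathbb{E}F_\tau F_\tau^*=e^\tau\,\mathrm{id}$ for all $\tau\ge 0$. Let $|F|^2=\mathrm{tr}\,FF^*$ denote the (squared) Frobenius norm. Then for every real $p\ge 1$ there are constants $0<c\le C<\infty$, depending only on $p$, such that $$c\,e^{\frac12 p(p+1)\tau}\;\le\;\mathbb{E}|F_\tau|^{2p}\;\le\; C\,e^{\frac12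 p(p+1)\tau}\qquad\text{for all }\tau\ge 0.$$ -/

import Mathlib

open MeasureTheory ProbabilityTheory
open scoped NNReal ENNReal Matrix

/-- The Frobenius norm `|A|`, given by `|A|² = tr (A A*)`; the adjoint `A*` with respect to the
Euclidean inner product is the transpose. -/
noncomputable def frobeniusNorm {n : ℕ} (A : Matrix (Fin n) (Fin n) ℝ) : ℝ :=
  Real.sqrt (A * Aᵀ).trace

/-- The Riemann sum `∑ F(π k) (B(π (k+1)) - B(π k))`, `k < m`, with left end points. -/
noncomputable def itoSum {Ω : Type*} {n : ℕ} (F B : ℝ≥0 → Ω → Matrix (Fin n) (Fin n) ℝ)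
    (m : ℕ) (π : ℕ → ℝ≥0) (ω : Ω) : Matrix (Fin n) (Fin n) ℝ :=
  ∑ k ∈ Finset.range m, F (π k) ω * (B (π (k + 1)) ω - B (π k) ω)

/-- The Riemann sum `∑ ½ (F(π k) + F(π (k+1))) (B(π (k+1)) - B(π k))`, `k < m`. -/
noncomputable def stratonovichSum {Ω : Type*} {n : ℕ}
    (F B : ℝ≥0 → Ω → Matrix (Fin n) (Fin n) ℝ)
    (m : ℕ) (π : ℕ → ℝ≥0) (ω : Ω) : Matrix (Fin n) (Fin n) ℝ :=
  ∑ k ∈ Finset.range m,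
    ((1 / 2 : ℝ) • (F (π k) ω + F (π (k + 1)) ω)) * (B (π (k + 1)) ω - B (π k) ω)

/-- For every `t`, the random matrices `S m π`, indexed by the partitions
`0 = π 0 ≤ π 1 ≤ … ≤ π m = t` of `[0, t]`, converge to `I t` in probability as the mesh of the
partition tends to zero. -/
def TendstoAlongPartitions {Ω : Type*} {n : ℕ} [MeasurableSpace Ω] (μ : Measure Ω)
    (S : ℕ → (ℕ → ℝ≥0) → Ω → Matrix (Fin n) (Fin n) ℝ)
    (I : ℝ≥0 → Ω → Matrix (Fin n) (Fin n) ℝ) : Prop :=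
  ∀ t : ℝ≥0, ∀ ε : ℝ, 0 < ε → ∀ η : ℝ≥0∞, 0 < η → ∃ δ : ℝ≥0, 0 < δ ∧
    ∀ (m : ℕ) (π : ℕ → ℝ≥0), Monotone π → π 0 = 0 → π m = t →
      (∀ k < m, π (k + 1) - π k ≤ δ) →
      μ {ω | ε ≤ frobeniusNorm (S m π ω - I t ω)} ≤ η

/-- `I t = ∫₀ᵗ F dB`, the Itô integral of a continuous adapted process `F`. -/
def IsItoIntegral {Ω : Type*} {n : ℕ} [MeasurableSpace Ω] (μ : Measure Ω)
    (F B I : ℝ≥0 → Ω → Matrix (Fin n) (Fin n) ℝ) : Prop :=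
  TendstoAlongPartitions μ (itoSum F B) I

/-- `I t = ∫₀ᵗ F ∘ dB`, the Stratonovich integral of a continuous adapted process `F`. -/
def IsStratonovichIntegral {Ω : Type*} {n : ℕ} [MeasurableSpace Ω] (μ : Measure Ω)
    (F B I : ℝ≥0 → Ω → Matrix (Fin n) (Fin n) ℝ) : Prop :=
  TendstoAlongPartitions μ (stratonovichSum F B) I

/-- `B` is a Brownian motion on the Lie algebra `𝔰𝔩(n)` of trace-free matrices, relative to the
filtration `ℱ`. Its covariance is not prescribed: `q G` is the variance of the linear functional
`X ↦ tr (X G)` of `B` at time `1`. -/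
structure IsBrownianMotionSL {Ω : Type*} {n : ℕ} [mΩ : MeasurableSpace Ω] (μ : Measure Ω)
    (ℱ : Filtration ℝ≥0 mΩ) (B : ℝ≥0 → Ω → Matrix (Fin n) (Fin n) ℝ) : Prop where
  adapted : ∀ t i j, Measurable[ℱ t] (fun ω => B t ω i j)
  continuous_paths : ∀ᵐ ω ∂μ, Continuous (fun t => B t ω)
  zero : ∀ᵐ ω ∂μ, B 0 ω = 0
  trace_zero : ∀ t, ∀ᵐ ω ∂μ, (B t ω).trace = 0
  indep : ∀ s t, s ≤ t →
    Indep (ℱ s)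
      (MeasurableSpace.comap (fun ω (i j : Fin n) => B t ω i j - B s ω i j) inferInstance) μ
  gaussian : ∃ q : Matrix (Fin n) (Fin n) ℝ → ℝ≥0, ∀ s t, s ≤ t → ∀ G,
    HasLaw (fun ω => ((B t ω - B s ω) * G).trace) (gaussianReal 0 ((t - s) * q G)) μ

/-- `F` is the geometric Brownian motion on `SL(n)` driven by `B`: the solution of the
Stratonovich equation `dF = F ∘ dB` with `F₀ = id`, where the Brownian motion `B` on `𝔰𝔩(n)` is
the one (unique in law) that is singled out by the properties `law_conj`, `ito_eq_stratonovich`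
and `normalization` of `F`. -/
structure IsGeometricBrownianMotionSL {Ω : Type*} {n : ℕ} [mΩ : MeasurableSpace Ω]
    (μ : Measure Ω) (ℱ : Filtration ℝ≥0 mΩ) (B F : ℝ≥0 → Ω → Matrix (Fin n) (Fin n) ℝ) :
    Prop where
  driver : IsBrownianMotionSL μ ℱ B
  adapted : ∀ t i j, Measurable[ℱ t] (fun ω => F t ω i j)
  continuous_paths : ∀ᵐ ω ∂μ, Continuous (fun t => F t ω)
  /-- `F₀ = id` -/
  initial : ∀ᵐ ω ∂μ, F 0 ω = 1
  /-- `dF = F ∘ dB` -/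
  equation : IsStratonovichIntegral μ F B (fun t ω => F t ω - F 0 ω)
  /-- `O F O⁻¹ = F` in law, as processes, for all `O ∈ O(n)` -/
  law_conj : ∀ O : Matrix.orthogonalGroup (Fin n) ℝ,
    IdentDistrib
      (fun ω (t : ℝ≥0) (i j : Fin n) =>
        ((O : Matrix (Fin n) (Fin n) ℝ) * F t ω *
          ((O⁻¹ : Matrix.orthogonalGroup (Fin n) ℝ) : Matrix (Fin n) (Fin n) ℝ)) i j)
      (fun ω (t : ℝ≥0) (i j : Fin n) => F t ω i j) μ μ
  /-- `F ∘ dB = F dB` -/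
  ito_eq_stratonovich : ∀ I : ℝ≥0 → Ω → Matrix (Fin n) (Fin n) ℝ,
    IsStratonovichIntegral μ F B I ↔ IsItoIntegral μ F B I
  /-- `𝔼 F_τ F_τ* = e^τ id` -/
  normalization : ∀ (τ : ℝ≥0) (i j : Fin n),
    Integrable (fun ω => (F τ ω * (F τ ω)ᵀ) i j) μ ∧
      ∫ ω, (F τ ω * (F τ ω)ᵀ) i j ∂μ =
        (Real.exp τ • (1 : Matrix (Fin n) (Fin n) ℝ)) i j

/-!
# Moments of the geometric Brownian motion on `SL(2)`

Let `u` be a row of `F`, so that `du = u dB` in the sense of Itô. The three properties of `F`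
determine the covariance form of `B`: the symmetric and the antisymmetric part of `B` are
uncorrelated, the former is isotropic, and both contribute equally to `𝔼 |B₁|² = 2`. For this form
the law of `|u (1 + ΔB)|² / |u|²` does not depend on the direction of `u`, and `|u|²` is
a scalar geometric Brownian motion, `d|u|² = |u|² (dτ + dW)`. Hence
`𝔼 |u_τ|^{2p} = exp (½ p (p + 1) τ)` exactly, and `|F|^{2p}` is comparable to the sum of the
`p`-th powers of the squared lengths of the two rows of `F`.

Mathlib has no stochastic calculus, and none is needed. The driving equation is used only through
its Riemann sums, and the moments are those of the Euler scheme `E_{k+1} = E_k (1 + ΔB_k)`.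

* Since `F` is square integrable by the normalization, the isometry for Riemann sums
  (`sum_mul_incr`) and Fatou's lemma show that the increments of `F` over a time `h` have second
  moments `O(h)`, and that the Riemann sums of step `h` differ from `F` by `O(h)` in second moment
  (`secondMoment_remainder`).
* `F_t - 1` agrees with `B_t` to leading order at small times. Comparing second moments, the
  covariance form is invariant under conjugation by `O(2)` (`covariance_conj`), and its size is
  given by the normalization (`covariance_row`). Twice the difference of the Stratonovich and the
  Itô sums is `∑ ΔF ΔB`, which is close to `𝔼 B₁² τ` for small `τ`; as the two integrals agree,
  `𝔼 B₁² = 0` (`meanSquare_eq_zero`). These facts leave a single form (`covariance_eq`).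
* A third order expansion of `(1 + z)^p` gives
  `𝔼 |u (1 + ΔB)|^{2p} = (1 + ½ p (p + 1) h + O(h^{3/2})) |u|^{2p}`, first for fixed and then, by
  independence, for random `u` (`exists_lintegral_stepNormSq_le`). Iterating, the moments of the
  rows of the Euler scheme converge to `exp (½ p (p + 1) τ)`.
* The Euler scheme converges to `F` in second moment by a discrete Grönwall argument
  (`secondMoment_sub_euler`). Its moments pass to the limit: from above by Fatou's lemma, and from
  below by Fatou's lemma for `ε |u|^{4p} + 1 / (4ε) - |u|^{2p} ≥ 0` (`le_integral_row_rpow`).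
-/

namespace GBM

open Filter Topology

/-! ### Second moments, convergence in measure and the discrete Itô isometry -/

section

variable {Ω : Type*} {mΩ : MeasurableSpace Ω} {μ : Measure Ω}

/-- `f` is square integrable and `𝔼 f² ≤ c`. Square integrability is included because the integral
of a function that is not integrable is `0`. -/
structure SecondMomentLE {Ω : Type*} {mΩ : MeasurableSpace Ω} (μ : Measure Ω) (f : Ω → ℝ) (c : ℝ) :
    Prop where
  memLp : MemLp f 2 μ
  le : ∫ ω, f ω ^ 2 ∂μ ≤ c

namespace SecondMomentLE

variable {f g : Ω → ℝ} {a b : ℝ}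

lemma mono (h : SecondMomentLE μ f a) (hab : a ≤ b) : SecondMomentLE μ f b := ⟨h.1, h.2.trans hab⟩

lemma nonneg (h : SecondMomentLE μ f a) : 0 ≤ a :=
  (integral_nonneg fun _ => sq_nonneg _).trans h.le

lemma congr (h : SecondMomentLE μ f a) (hfg : f =ᵐ[μ] g) : SecondMomentLE μ g a := by
  refine ⟨h.1.ae_eq hfg, le_of_eq_of_le (integral_congr_ae ?_) h.2⟩
  filter_upwards [hfg] with ω hω
  rw [hω]

lemma add (hf : SecondMomentLE μ f a) (hg : SecondMomentLE μ g b) :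
    SecondMomentLE μ (fun ω => f ω + g ω) (2 * a + 2 * b) := by
  refine ⟨hf.1.add hg.1, ?_⟩
  calc ∫ ω, (f ω + g ω) ^ 2 ∂μ ≤ ∫ ω, (2 * f ω ^ 2 + 2 * g ω ^ 2) ∂μ := by
        refine integral_mono (hf.1.add hg.1).integrable_sq
          ((hf.1.integrable_sq.const_mul 2).add (hg.1.integrable_sq.const_mul 2)) fun ω => ?_
        simp only
        nlinarith [sq_nonneg (f ω - g ω)]
    _ = 2 * ∫ ω, f ω ^ 2 ∂μ + 2 * ∫ ω, g ω ^ 2 ∂μ := by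
        rw [integral_add (hf.1.integrable_sq.const_mul 2) (hg.1.integrable_sq.const_mul 2),
          integral_const_mul, integral_const_mul]
    _ ≤ _ := by linarith [hf.2, hg.2]

lemma const_mul (hf : SecondMomentLE μ f a) (k : ℝ) :
    SecondMomentLE μ (fun ω => k * f ω) (k ^ 2 * a) := by
  refine ⟨hf.1.const_mul k, ?_⟩
  simp_rw [mul_pow]
  rw [integral_const_mul]
  exact mul_le_mul_of_nonneg_left hf.2 (sq_nonneg k)

lemma neg (hf : SecondMomentLE μ f a) : SecondMomentLE μ (fun ω => -f ω) a := by
  refine ⟨hf.1.neg, ?_⟩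
  simpa using hf.2

lemma sub (hf : SecondMomentLE μ f a) (hg : SecondMomentLE μ g b) :
    SecondMomentLE μ (fun ω => f ω - g ω) (2 * a + 2 * b) := by
  simpa [sub_eq_add_neg] using hf.add hg.neg

lemma sum {f : ℕ → Ω → ℝ} (n : ℕ) (h : ∀ k < n, SecondMomentLE μ (f k) a) :
    SecondMomentLE μ (fun ω => ∑ k ∈ Finset.range n, f k ω) (n ^ 2 * a) := by
  have hm : ∀ k ∈ Finset.range n, MemLp (f k) 2 μ := fun k hk => (h k (Finset.mem_range.1 hk)).1
  refine ⟨memLp_finsetSum _ hm, ?_⟩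
  calc ∫ ω, (∑ k ∈ Finset.range n, f k ω) ^ 2 ∂μ
      ≤ ∫ ω, n * ∑ k ∈ Finset.range n, f k ω ^ 2 ∂μ := by
        refine integral_mono (memLp_finsetSum _ hm).integrable_sq
          ((integrable_finsetSum _ fun k hk => (hm k hk).integrable_sq).const_mul _) fun ω => ?_
        simpa using sq_sum_le_card_mul_sum_sq (s := Finset.range n) (f := fun k => f k ω)
    _ = n * ∑ k ∈ Finset.range n, ∫ ω, f k ω ^ 2 ∂μ := by
        rw [integral_const_mul, integral_finsetSum _ fun k hk => (hm k hk).integrable_sq]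
    _ ≤ n * ∑ k ∈ Finset.range n, a := by
        gcongr with k hk
        exact (h k (Finset.mem_range.1 hk)).2
    _ = n ^ 2 * a := by simp; ring

end SecondMomentLE

/-- Young's inequality for the mean of a product. -/
lemma integral_abs_mul_le {f g : Ω → ℝ} {a b s : ℝ} (hf : SecondMomentLE μ f a)
    (hg : SecondMomentLE μ g b) (hs : 0 < s) :
    ∫ ω, |f ω * g ω| ∂μ ≤ s * a + b / s := by
  calc ∫ ω, |f ω * g ω| ∂μ ≤ ∫ ω, (s * f ω ^ 2 + s⁻¹ * g ω ^ 2) ∂μ := by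
        refine integral_mono (hf.1.integrable_mul hg.1).abs
          ((hf.1.integrable_sq.const_mul s).add (hg.1.integrable_sq.const_mul s⁻¹)) fun ω => ?_
        simp only
        have h0 : s * s⁻¹ = 1 := mul_inv_cancel₀ hs.ne'
        have h1 := sq_nonneg (s * |f ω| - |g ω|)
        have h2 : 0 ≤ s⁻¹ := (inv_pos.2 hs).le
        have h3 := mul_nonneg h2 h1
        have h4 : s⁻¹ * (s * |f ω| - |g ω|) ^ 2
            = s * |f ω| ^ 2 + s⁻¹ * |g ω| ^ 2 - 2 * (|f ω| * |g ω|) := by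
          field_simp
          ring
        rw [h4, sq_abs, sq_abs] at h3
        rw [abs_mul]
        have := mul_nonneg (abs_nonneg (f ω)) (abs_nonneg (g ω))
        linarith
    _ = s * ∫ ω, f ω ^ 2 ∂μ + s⁻¹ * ∫ ω, g ω ^ 2 ∂μ := by
        rw [integral_add (hf.1.integrable_sq.const_mul _) (hg.1.integrable_sq.const_mul _),
          integral_const_mul, integral_const_mul]
    _ ≤ s * a + s⁻¹ * b := by
        gcongr
        · exact hf.2
        · exact hg.2
    _ = _ := by ring

lemma TendstoInMeasure.add_real {X Y : ℕ → Ω → ℝ} {x y : Ω → ℝ}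
    (hX : TendstoInMeasure μ X atTop x) (hY : TendstoInMeasure μ Y atTop y) :
    TendstoInMeasure μ (fun n ω => X n ω + Y n ω) atTop (fun ω => x ω + y ω) := by
  rw [tendstoInMeasure_iff_norm] at hX hY ⊢
  intro ε hε
  have h := (hX (ε / 2) (half_pos hε)).add (hY (ε / 2) (half_pos hε))
  rw [add_zero] at h
  refine tendsto_of_tendsto_of_tendsto_of_le_of_le tendsto_const_nhds h (fun _ => zero_le)
    fun n => (measure_mono fun ω hω => ?_).trans (measure_union_le _ _)
  by_contra hc
  simp only [Set.mem_union, Set.mem_ofPred_eq, not_or, not_le] at hc hω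
  have := norm_add_le (X n ω - x ω) (Y n ω - y ω)
  rw [show X n ω - x ω + (Y n ω - y ω) = X n ω + Y n ω - (x ω + y ω) by ring] at this
  linarith [hc.1, hc.2]

lemma TendstoInMeasure.const_mul_real {X : ℕ → Ω → ℝ} {x : Ω → ℝ}
    (hX : TendstoInMeasure μ X atTop x) (k : ℝ) :
    TendstoInMeasure μ (fun n ω => k * X n ω) atTop (fun ω => k * x ω) := by
  rw [tendstoInMeasure_iff_norm] at hX ⊢
  intro ε hε
  have hk : 0 < |k| + 1 := by positivity
  refine tendsto_of_tendsto_of_tendsto_of_le_of_le tendsto_const_nhds (hX (ε / (|k| + 1))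
    (by positivity)) (fun _ => zero_le) fun n => measure_mono fun ω hω => ?_
  simp only [Set.mem_ofPred_eq] at hω ⊢
  rw [div_le_iff₀ hk]
  rw [← mul_sub, norm_mul, Real.norm_eq_abs k] at hω
  nlinarith [norm_nonneg (X n ω - x ω)]

lemma tendstoInMeasure_const_real (x : Ω → ℝ) :
    TendstoInMeasure μ (fun _ : ℕ => x) atTop x := by
  rw [tendstoInMeasure_iff_norm]
  intro ε hε
  simp [not_le.2 hε]

lemma tendstoInMeasure_of_integral_abs_le {X : ℕ → Ω → ℝ} {c : ℕ → ℝ}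
    (hX : ∀ n, Integrable (X n) μ) (hc : Tendsto c atTop (𝓝 0))
    (h : ∀ᶠ n in atTop, ∫ ω, |X n ω| ∂μ ≤ c n) :
    TendstoInMeasure μ X atTop (fun _ => 0) := by
  refine tendstoInMeasure_of_tendsto_eLpNorm one_ne_zero (fun n => (hX n).1)
    aestronglyMeasurable_const ?_
  have h0 : Tendsto (fun n => ENNReal.ofReal (c n)) atTop (𝓝 0) := by
    simpa using ENNReal.tendsto_ofReal hc
  refine tendsto_of_tendsto_of_tendsto_of_le_of_le' tendsto_const_nhds h0
    (Eventually.of_forall fun _ => zero_le) ?_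
  filter_upwards [h] with n hn
  rw [eLpNorm_one_eq_lintegral_enorm]
  calc ∫⁻ ω, ‖(X n - fun _ => (0 : ℝ) : Ω → ℝ) ω‖ₑ ∂μ = ∫⁻ ω, ENNReal.ofReal |X n ω| ∂μ := by
        simp [Real.enorm_eq_ofReal_abs]
    _ = ENNReal.ofReal (∫ ω, |X n ω| ∂μ) :=
        (ofReal_integral_eq_lintegral_ofReal (hX n).abs (ae_of_all _ fun _ => abs_nonneg _)).symm
    _ ≤ _ := ENNReal.ofReal_le_ofReal hn

/-- Chebyshev's inequality: convergence in second moment implies convergence in probability. -/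
lemma SecondMomentLE.tendstoInMeasure [IsProbabilityMeasure μ] {X : ℕ → Ω → ℝ} {x : Ω → ℝ}
    {c : ℕ → ℝ} (hc : Tendsto c atTop (𝓝 0))
    (h : ∀ᶠ n in atTop, SecondMomentLE μ (fun ω => X n ω - x ω) (c n)) :
    TendstoInMeasure μ X atTop x := by
  rw [tendstoInMeasure_iff_norm]
  intro ε hε
  have h0 : Tendsto (fun n => ENNReal.ofReal (c n / ε ^ 2)) atTop (𝓝 0) := by
    simpa using ENNReal.tendsto_ofReal (hc.div_const (ε ^ 2))
  refine tendsto_of_tendsto_of_tendsto_of_le_of_le' tendsto_const_nhds h0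
    (Eventually.of_forall fun _ => zero_le) ?_
  filter_upwards [h] with n hn
  have h1 := mul_meas_ge_le_integral_of_nonneg (μ := μ) (f := fun ω => (X n ω - x ω) ^ 2)
    (ae_of_all _ fun ω => sq_nonneg _) hn.1.integrable_sq (ε ^ 2)
  have h2 : {ω | ε ≤ ‖X n ω - x ω‖} = {ω | ε ^ 2 ≤ (X n ω - x ω) ^ 2} := by
    ext ω
    simp only [Set.mem_ofPred_eq, Real.norm_eq_abs]
    rw [sq_le_sq, abs_of_pos hε]
  rw [h2, ← ofReal_measureReal (measure_ne_top _ _)]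
  apply ENNReal.ofReal_le_ofReal
  rw [le_div_iff₀ (by positivity), mul_comm]
  exact h1.trans hn.2

/-- Fatou's lemma along a pair of sequences that converge in probability. -/
lemma lintegral_le_of_tendstoInMeasure {X Y : ℕ → Ω → ℝ} {x y : Ω → ℝ}
    (hX : TendstoInMeasure μ X atTop x) (hY : TendstoInMeasure μ Y atTop y)
    (hXm : ∀ n, Measurable (X n)) (hYm : ∀ n, Measurable (Y n))
    {g : ℝ × ℝ → ℝ} (hg : Continuous g) {c : ℕ → ℝ≥0∞} {c' : ℝ≥0∞} (hc : Tendsto c atTop (𝓝 c'))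
    (h : ∀ᶠ n in atTop, ∫⁻ ω, ENNReal.ofReal (g (X n ω, Y n ω)) ∂μ ≤ c n) :
    ∫⁻ ω, ENNReal.ofReal (g (x ω, y ω)) ∂μ ≤ c' := by
  obtain ⟨ns, hns, h1⟩ := hX.exists_seq_tendsto_ae
  obtain ⟨ms, hms, h2⟩ := (hY.comp hns.tendsto_atTop).exists_seq_tendsto_ae
  have hlim : Tendsto (fun k => ns (ms k)) atTop atTop :=
    hns.tendsto_atTop.comp hms.tendsto_atTop
  have h3 : ∀ᵐ ω ∂μ, Tendsto (fun k => ENNReal.ofReal (g (X (ns (ms k)) ω, Y (ns (ms k)) ω)))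
      atTop (𝓝 (ENNReal.ofReal (g (x ω, y ω)))) := by
    filter_upwards [h1, h2] with ω hω1 hω2
    exact ENNReal.tendsto_ofReal ((hg.tendsto _).comp
      ((hω1.comp hms.tendsto_atTop).prodMk_nhds hω2))
  calc ∫⁻ ω, ENNReal.ofReal (g (x ω, y ω)) ∂μ
      = ∫⁻ ω, liminf (fun k => ENNReal.ofReal (g (X (ns (ms k)) ω, Y (ns (ms k)) ω))) atTop ∂μ := by
        refine lintegral_congr_ae ?_
        filter_upwards [h3] with ω hω
        exact hω.liminf_eq.symm
    _ ≤ liminf (fun k => ∫⁻ ω, ENNReal.ofReal (g (X (ns (ms k)) ω, Y (ns (ms k)) ω)) ∂μ) atTop :=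
        lintegral_liminf_le fun k => ENNReal.measurable_ofReal.comp
          (hg.measurable.comp ((hXm _).prodMk (hYm _)))
    _ ≤ liminf (fun k => c (ns (ms k))) atTop := liminf_le_liminf (hlim.eventually h)
    _ = c' := (hc.comp hlim).liminf_eq

lemma SecondMomentLE.of_tendstoInMeasure {X : ℕ → Ω → ℝ} {x : Ω → ℝ}
    (hX : TendstoInMeasure μ X atTop x) (hXm : ∀ n, Measurable (X n)) (hx : Measurable x)
    {c : ℕ → ℝ} {c' : ℝ} (hc : Tendsto c atTop (𝓝 c'))
    (h : ∀ᶠ n in atTop, SecondMomentLE μ (X n) (c n)) : SecondMomentLE μ x c' := by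
  have h1 : ∫⁻ ω, ENNReal.ofReal (x ω ^ 2) ∂μ ≤ ENNReal.ofReal c' := by
    refine lintegral_le_of_tendstoInMeasure hX hX hXm hXm (g := fun z => z.1 ^ 2) (by fun_prop)
      (ENNReal.tendsto_ofReal hc) ?_
    filter_upwards [h] with n hn
    rw [← ofReal_integral_eq_lintegral_ofReal hn.1.integrable_sq (ae_of_all _ fun _ => sq_nonneg _)]
    exact ENNReal.ofReal_le_ofReal hn.2
  have hc0 : 0 ≤ c' := ge_of_tendsto hc (h.mono fun n hn => hn.nonneg)
  have hm : AEStronglyMeasurable (fun ω => x ω ^ 2) μ := (hx.pow_const 2).aestronglyMeasurable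
  have hi : Integrable (fun ω => x ω ^ 2) μ := by
    rw [← lintegral_ofReal_ne_top_iff_integrable hm (ae_of_all _ fun _ => sq_nonneg _)]
    exact (h1.trans_lt ENNReal.ofReal_lt_top).ne
  refine ⟨(memLp_two_iff_integrable_sq hx.aestronglyMeasurable).2 hi, ?_⟩
  rw [← ofReal_integral_eq_lintegral_ofReal hi (ae_of_all _ fun _ => sq_nonneg _)] at h1
  exact (ENNReal.ofReal_le_ofReal_iff hc0).1 h1

lemma indepFun_of_indep {m : MeasurableSpace Ω} {β γ : Type*} [MeasurableSpace β]
    [mγ : MeasurableSpace γ] {G : Ω → β} {ξ : Ω → γ} (hG : Measurable[m] G)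
    (h : Indep m (MeasurableSpace.comap ξ mγ) μ) : G ⟂ᵢ[μ] ξ := by
  rw [IndepFun_iff_Indep]
  exact indep_of_indep_of_le_left h hG.comap_le

lemma IndepFun.memLp_two_mul {G ξ : Ω → ℝ} (h : G ⟂ᵢ[μ] ξ) (hG : MemLp G 2 μ)
    (hξ : MemLp ξ 2 μ) : MemLp (fun ω => G ω * ξ ω) 2 μ := by
  refine (memLp_two_iff_integrable_sq (f := fun ω => G ω * ξ ω) (hG.1.mul hξ.1)).2 ?_
  simp_rw [mul_pow]
  exact (h.comp (φ := fun x => x ^ 2) (ψ := fun x => x ^ 2) (measurable_id.pow_const 2)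
    (measurable_id.pow_const 2)).integrable_mul hG.integrable_sq hξ.integrable_sq

/-- The discrete Itô isometry: if `G k` is known at time `k` and `ξ k` is centred and independent
of the past up to time `k`, then the terms of `∑ G k * ξ k` are centred and orthogonal. -/
theorem isometry_sum_mul [IsProbabilityMeasure μ] {𝒢 : ℕ → MeasurableSpace Ω} (h𝒢 : Monotone 𝒢)
    {G ξ : ℕ → Ω → ℝ} (hG : ∀ k, Measurable[𝒢 k] (G k))
    (hG2 : ∀ k, MemLp (G k) 2 μ) (hξ : ∀ k, Measurable[𝒢 (k + 1)] (ξ k))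
    (hξ2 : ∀ k, MemLp (ξ k) 2 μ)
    (hind : ∀ k, Indep (𝒢 k) (MeasurableSpace.comap (ξ k) inferInstance) μ)
    (h0 : ∀ k, ∫ ω, ξ k ω ∂μ = 0) (n : ℕ) :
    Measurable[𝒢 n] (fun ω => ∑ k ∈ Finset.range n, G k ω * ξ k ω) ∧
    MemLp (fun ω => ∑ k ∈ Finset.range n, G k ω * ξ k ω) 2 μ ∧
    ∫ ω, (∑ k ∈ Finset.range n, G k ω * ξ k ω) ∂μ = 0 ∧
    ∫ ω, (∑ k ∈ Finset.range n, G k ω * ξ k ω) ^ 2 ∂μ =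
      ∑ k ∈ Finset.range n, (∫ ω, G k ω ^ 2 ∂μ) * ∫ ω, ξ k ω ^ 2 ∂μ := by
  induction n with
  | zero =>
    refine ⟨by simp, by simp, by simp, by simp⟩
  | succ n ih =>
    obtain ⟨ih1, ih2, ih3, ih4⟩ := ih
    have hi : G n ⟂ᵢ[μ] ξ n := indepFun_of_indep (hG n) (hind n)
    have hp : MemLp (fun ω => G n ω * ξ n ω) 2 μ := IndepFun.memLp_two_mul hi (hG2 n) (hξ2 n)
    simp_rw [Finset.sum_range_succ]
    refine ⟨?_, ih2.add hp, ?_, ?_⟩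
    · exact (ih1.mono (h𝒢 n.le_succ) le_rfl).add
        (((hG n).mono (h𝒢 n.le_succ) le_rfl).mul (hξ n))
    · rw [integral_add (ih2.integrable (by norm_num)) (hp.integrable (by norm_num)), ih3, zero_add,
        hi.integral_fun_mul_eq_mul_integral (hG2 n).1 (hξ2 n).1, h0, mul_zero]
    · set S : Ω → ℝ := fun ω => ∑ k ∈ Finset.range n, G k ω * ξ k ω with hS
      have hSG : (fun ω => S ω * G n ω) ⟂ᵢ[μ] ξ n := indepFun_of_indep (ih1.mul (hG n)) (hind n)
      have hi2 : (fun ω => G n ω ^ 2) ⟂ᵢ[μ] (fun ω => ξ n ω ^ 2) :=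
        hi.comp (φ := fun x => x ^ 2) (ψ := fun x => x ^ 2) (measurable_id.pow_const 2)
          (measurable_id.pow_const 2)
      -- `S * G n` is known at time `n`, so the cross term has mean zero.
      have hcross : ∫ ω, S ω * G n ω * ξ n ω ∂μ = 0 := by
        rw [hSG.integral_fun_mul_eq_mul_integral (ih2.integrable_mul (hG2 n)).1 (hξ2 n).1, h0,
          mul_zero]
      have hcrossi : Integrable (fun ω => S ω * G n ω * ξ n ω) μ :=
        hSG.integrable_mul (ih2.integrable_mul (hG2 n)) ((hξ2 n).integrable (by norm_num))
      have hsq : ∫ ω, G n ω ^ 2 * ξ n ω ^ 2 ∂μ = (∫ ω, G n ω ^ 2 ∂μ) * ∫ ω, ξ n ω ^ 2 ∂μ :=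
        hi2.integral_fun_mul_eq_mul_integral (hG2 n).integrable_sq.1 (hξ2 n).integrable_sq.1
      have hsqi : Integrable (fun ω => G n ω ^ 2 * ξ n ω ^ 2) μ :=
        hi2.integrable_mul (hG2 n).integrable_sq (hξ2 n).integrable_sq
      calc ∫ ω, (S ω + G n ω * ξ n ω) ^ 2 ∂μ
          = ∫ ω, (S ω ^ 2 + 2 * (S ω * G n ω * ξ n ω) + G n ω ^ 2 * ξ n ω ^ 2) ∂μ := by
            congr 1; ext ω; ring
        _ = _ := by
            have hsum : Integrable (fun ω => S ω ^ 2 + 2 * (S ω * G n ω * ξ n ω)) μ :=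
              ih2.integrable_sq.add (hcrossi.const_mul 2)
            rw [integral_add hsum hsqi,
              integral_add ih2.integrable_sq (hcrossi.const_mul 2), integral_const_mul, hcross, hsq,
              ih4]
            ring

end

/-! ### Increments of the Brownian motion -/

section

variable {Ω : Type*} {mΩ : MeasurableSpace Ω} {μ : Measure Ω} {ℱ : Filtration ℝ≥0 mΩ}
  {B : ℝ≥0 → Ω → Matrix (Fin 2) (Fin 2) ℝ} {q : Matrix (Fin 2) (Fin 2) ℝ → ℝ≥0}

lemma trace_mul_single_two (X : Matrix (Fin 2) (Fin 2) ℝ) (i j : Fin 2) :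
    (X * Matrix.single j i (1 : ℝ)).trace = X i j := by
  rw [Matrix.trace_mul_single]; simp

/-- The weighted moments of order `k` of a centred Gaussian of variance `h * v` are `O(h^{k/2})` as
`h → 0`, by scaling. -/
lemma gaussian_moment_le {Ω : Type*} {_ : MeasurableSpace Ω} (μ : Measure Ω)
    (v : ℝ≥0) (k r : ℕ) (L : ℝ≥0) :
    ∃ M : ℝ, 0 ≤ M ∧ ∀ h : ℝ≥0, h ≤ 1 → ∀ X : Ω → ℝ, HasLaw X (gaussianReal 0 (h * v)) μ →
      Integrable (fun ω => |X ω| ^ k * (1 + L * |X ω|) ^ r) μ ∧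
        ∫ ω, |X ω| ^ k * (1 + L * |X ω|) ^ r ∂μ ≤ M * √(h : ℝ) ^ k := by
  have hint : ∀ w : ℝ≥0, Integrable (fun x : ℝ => |x| ^ k * (1 + L * |x|) ^ r)
      (gaussianReal 0 w) := by
    intro w
    have hpow : ∀ n : ℕ, Integrable (fun x : ℝ => |x| ^ n) (gaussianReal 0 w) := by
      intro n
      simpa using (memLp_id_gaussianReal (μ := 0) (v := w) n).integrable_norm_pow' 
    have : (fun x : ℝ => |x| ^ k * (1 + L * |x|) ^ r) = fun x : ℝ =>
        ∑ m ∈ Finset.range (r + 1), ((L : ℝ) ^ m * r.choose m) * |x| ^ (k + m) := by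
      ext x
      rw [add_comm (1 : ℝ), add_pow, Finset.mul_sum]
      refine Finset.sum_congr rfl fun m _ => ?_
      rw [one_pow, mul_pow, pow_add]
      ring
    rw [this]
    exact integrable_finsetSum _ fun m _ => (hpow _).const_mul _
  refine ⟨∫ x, |x| ^ k * (1 + L * |x|) ^ r ∂(gaussianReal 0 v),
    integral_nonneg fun x => by positivity, ?_⟩
  intro h hh X hX
  have hX' : Integrable (fun ω => |X ω| ^ k * (1 + L * |X ω|) ^ r) μ := by
    have h1 := hint (h * v)
    rw [← hX.map_eq] at h1
    exact h1.comp_aemeasurable hX.aemeasurable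
  refine ⟨hX', ?_⟩
  have hlaw : gaussianReal 0 (h * v) = (gaussianReal 0 v).map (fun x => √(h : ℝ) * x) := by
    rw [gaussianReal_map_const_mul]
    congr 1
    · simp
    · congr 1
      ext
      simp [Real.sq_sqrt]
  have hm : Measurable (fun x : ℝ => |x| ^ k * (1 + L * |x|) ^ r) := by fun_prop
  have h1 : ∫ ω, |X ω| ^ k * (1 + L * |X ω|) ^ r ∂μ
      = ∫ x, |√(h : ℝ) * x| ^ k * (1 + L * |√(h : ℝ) * x|) ^ r ∂(gaussianReal 0 v) := by
    rw [← integral_map (φ := fun x => √(h : ℝ) * x)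
        (f := fun x : ℝ => |x| ^ k * (1 + L * |x|) ^ r) (by fun_prop) hm.aestronglyMeasurable,
      ← hlaw, ← hX.map_eq, integral_map hX.aemeasurable hm.aestronglyMeasurable]
  rw [h1, ← integral_mul_const]
  have hs1 : √(h : ℝ) ≤ 1 := Real.sqrt_le_one.2 (by exact_mod_cast hh)
  refine integral_mono_of_nonneg (ae_of_all _ fun x => by positivity)
    ((hint v).mul_const _) (ae_of_all _ fun x => ?_)
  simp only
  rw [abs_mul, abs_of_nonneg (Real.sqrt_nonneg _), mul_pow]
  have h2 : (1 + (L : ℝ) * (√(h : ℝ) * |x|)) ^ r ≤ (1 + L * |x|) ^ r := by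
    gcongr
    exact mul_le_of_le_one_left (abs_nonneg x) hs1
  calc √(h : ℝ) ^ k * |x| ^ k * (1 + (L : ℝ) * (√(h : ℝ) * |x|)) ^ r
      ≤ √(h : ℝ) ^ k * |x| ^ k * (1 + L * |x|) ^ r := by gcongr
    _ = _ := by ring

/-- `q` is the covariance form of `B`: the increments of `B` are centred Gaussian, and `q G` is the
variance per unit time of the linear functional `X ↦ tr (X G)`. The entry `X i j` corresponds to
`G = Matrix.single j i 1`. -/
def HasCovarianceForm {Ω : Type*} {mΩ : MeasurableSpace Ω} (μ : Measure Ω)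
    (B : ℝ≥0 → Ω → Matrix (Fin 2) (Fin 2) ℝ) (q : Matrix (Fin 2) (Fin 2) ℝ → ℝ≥0) : Prop :=
  ∀ s t, s ≤ t → ∀ G, HasLaw (fun ω => ((B t ω - B s ω) * G).trace)
    (gaussianReal 0 ((t - s) * q G)) μ

namespace HasCovarianceForm

variable (hq : HasCovarianceForm μ B q) {s t : ℝ≥0}
include hq

lemma memLp_two (hst : s ≤ t) (G : Matrix (Fin 2) (Fin 2) ℝ) :
    MemLp (fun ω => ((B t ω - B s ω) * G).trace) 2 μ := by
  have h := hq s t hst G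
  have h1 := memLp_id_gaussianReal' (μ := 0) (v := (t - s) * q G) 2 (by simp)
  rw [← h.map_eq] at h1
  exact h1.comp_of_map h.aemeasurable

lemma integral_eq_zero (hst : s ≤ t) (G : Matrix (Fin 2) (Fin 2) ℝ) :
    ∫ ω, ((B t ω - B s ω) * G).trace ∂μ = 0 := by
  rw [(hq s t hst G).integral_eq, integral_id_gaussianReal]

lemma integral_sq [IsProbabilityMeasure μ] (hst : s ≤ t) (G : Matrix (Fin 2) (Fin 2) ℝ) :
    ∫ ω, ((B t ω - B s ω) * G).trace ^ 2 ∂μ = (t - s) * q G := by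
  have h := (hq s t hst G).variance_eq
  rw [variance_id_gaussianReal, variance_eq_sub (hq.memLp_two hst G),
    hq.integral_eq_zero hst] at h
  simp only [Pi.pow_apply] at h
  rw [NNReal.coe_mul, NNReal.coe_sub hst] at h
  linarith

lemma memLp_two_entry (hst : s ≤ t) (i j : Fin 2) :
    MemLp (fun ω => (B t ω - B s ω) i j) 2 μ := by
  simpa only [trace_mul_single_two] using hq.memLp_two hst (Matrix.single j i 1)

lemma integral_entry (hst : s ≤ t) (i j : Fin 2) : ∫ ω, (B t ω - B s ω) i j ∂μ = 0 := by
  simpa only [trace_mul_single_two] using hq.integral_eq_zero hst (Matrix.single j i 1)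

lemma integral_entry_sq [IsProbabilityMeasure μ] (hst : s ≤ t) (i j : Fin 2) :
    ∫ ω, (B t ω - B s ω) i j ^ 2 ∂μ = (t - s) * q (Matrix.single j i 1) := by
  simpa only [trace_mul_single_two] using hq.integral_sq hst (Matrix.single j i 1)

lemma hasLaw_entry (hst : s ≤ t) (i j : Fin 2) :
    HasLaw (fun ω => (B t ω - B s ω) i j)
      (gaussianReal 0 ((t - s) * q (Matrix.single j i 1))) μ := by
  simpa only [trace_mul_single_two] using hq s t hst (Matrix.single j i 1)

end HasCovarianceForm

namespace IsBrownianMotionSL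

variable (hB : IsBrownianMotionSL μ ℱ B)
include hB

lemma measurable_incr_filtration {s t : ℝ≥0} (hst : s ≤ t) (i j : Fin 2) :
    Measurable[ℱ t] (fun ω => (B t ω - B s ω) i j) :=
  (hB.adapted t i j).sub ((hB.adapted s i j).mono (ℱ.mono hst) le_rfl)

lemma indep_comp {s t : ℝ≥0} (hst : s ≤ t) {β : Type*} [mβ : MeasurableSpace β]
    {f : (Fin 2 → Fin 2 → ℝ) → β} (hf : Measurable f) :
    Indep (ℱ s) (MeasurableSpace.comap (fun ω => f (fun i j => B t ω i j - B s ω i j)) mβ) μ := by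
  refine indep_of_indep_of_le_right (hB.indep s t hst) ?_
  rw [show (fun ω => f (fun i j => B t ω i j - B s ω i j))
    = f ∘ (fun ω i j => B t ω i j - B s ω i j) from rfl, ← MeasurableSpace.comap_comp]
  exact MeasurableSpace.comap_mono hf.comap_le

lemma indep_entry {s t : ℝ≥0} (hst : s ≤ t) (i j : Fin 2) :
    Indep (ℱ s) (MeasurableSpace.comap (fun ω => (B t ω - B s ω) i j) inferInstance) μ :=
  indep_comp hB hst (f := fun x => x i j) (by fun_prop)

end IsBrownianMotionSL

/-- The constant in the isometry `sum_mul_incr` for matrix-valued Riemann sums. It is not optimal: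
the factor `2` comes from bounding the square of a sum of two terms. -/
noncomputable def isometryConst (q : Matrix (Fin 2) (Fin 2) ℝ → ℝ≥0) : ℝ :=
  2 * ∑ l, ∑ j, (q (Matrix.single j l 1) : ℝ)

lemma isometryConst_nonneg (q : Matrix (Fin 2) (Fin 2) ℝ → ℝ≥0) : 0 ≤ isometryConst q := by
  unfold isometryConst; positivity

/-- The Itô isometry for matrix-valued Riemann sums, as an inequality that holds for each entry:
if the entries of the adapted integrands `H k` have second moments at most `g k`, then those of
`∑ H k * ΔB k` are centred with second moments at most a constant times `∑ g k * Δπ k`. -/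
theorem sum_mul_incr [IsProbabilityMeasure μ] (hB : IsBrownianMotionSL μ ℱ B)
    (hq : HasCovarianceForm μ B q) {π : ℕ → ℝ≥0} (hπ : Monotone π)
    {H : ℕ → Ω → Matrix (Fin 2) (Fin 2) ℝ}
    (hH : ∀ k i j, Measurable[ℱ (π k)] (fun ω => H k ω i j))
    (hH2 : ∀ k i j, MemLp (fun ω => H k ω i j) 2 μ) {g : ℕ → ℝ} (n : ℕ)
    (hg : ∀ k < n, ∀ i j, SecondMomentLE μ (fun ω => H k ω i j) (g k)) (i j : Fin 2) :
    SecondMomentLE μ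
      (fun ω => (∑ k ∈ Finset.range n, H k ω * (B (π (k + 1)) ω - B (π k) ω)) i j)
      (isometryConst q * ∑ k ∈ Finset.range n, g k * ((π (k + 1) : ℝ) - π k)) ∧
    ∫ ω, (∑ k ∈ Finset.range n, H k ω * (B (π (k + 1)) ω - B (π k) ω)) i j ∂μ = 0 := by
  have hstep : ∀ k, π k ≤ π (k + 1) := fun k => hπ k.le_succ
  have key : ∀ l, _ := fun l => isometry_sum_mul (μ := μ) (𝒢 := fun k => ℱ (π k))
    (fun a b hab => ℱ.mono (hπ hab)) (G := fun k ω => H k ω i l)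
    (ξ := fun k ω => (B (π (k + 1)) ω - B (π k) ω) l j) (fun k => hH k i l) (fun k => hH2 k i l)
    (fun k => IsBrownianMotionSL.measurable_incr_filtration hB (hstep k) l j)
    (fun k => hq.memLp_two_entry (hstep k) l j)
    (fun k => IsBrownianMotionSL.indep_entry hB (hstep k) l j)
    (fun k => hq.integral_entry (hstep k) l j) n
  have hsm : ∀ l, SecondMomentLE μ
      (fun ω => ∑ k ∈ Finset.range n, H k ω i l * (B (π (k + 1)) ω - B (π k) ω) l j)
      (q (Matrix.single j l 1) * ∑ k ∈ Finset.range n, g k * ((π (k + 1) : ℝ) - π k)) := by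
    intro l
    refine ⟨(key l).2.1, (key l).2.2.2.le.trans ?_⟩
    rw [Finset.mul_sum]
    refine Finset.sum_le_sum fun k hk => ?_
    rw [hq.integral_entry_sq (hstep k)]
    have h1 : (0 : ℝ) ≤ (π (k + 1) : ℝ) - π k := sub_nonneg.2 (by exact_mod_cast hstep k)
    have h2 := (hg k (Finset.mem_range.1 hk) i l).2
    calc _ ≤ g k * (((π (k + 1) : ℝ) - π k) * q (Matrix.single j l 1)) := by gcongr
      _ = _ := by ring
  have heq : (fun ω => (∑ k ∈ Finset.range n, H k ω * (B (π (k + 1)) ω - B (π k) ω)) i j)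
      = fun ω => (∑ k ∈ Finset.range n, H k ω i 0 * (B (π (k + 1)) ω - B (π k) ω) 0 j)
        + ∑ k ∈ Finset.range n, H k ω i 1 * (B (π (k + 1)) ω - B (π k) ω) 1 j := by
    ext ω
    rw [Matrix.sum_apply, ← Finset.sum_add_distrib]
    simp [Matrix.mul_apply, Fin.sum_univ_two]
  have h0 : 0 ≤ ∑ k ∈ Finset.range n, g k * ((π (k + 1) : ℝ) - π k) :=
    Finset.sum_nonneg fun k hk => mul_nonneg (hg k (Finset.mem_range.1 hk) 0 0).nonneg
      (sub_nonneg.2 (by exact_mod_cast hstep k))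
  rw [heq]
  constructor
  · refine ((hsm 0).add (hsm 1)).mono ?_
    rw [← mul_assoc, ← mul_assoc, ← add_mul]
    refine mul_le_mul_of_nonneg_right ?_ h0
    unfold isometryConst
    simp only [Fin.sum_univ_two]
    have e : ∀ a b : Fin 2, (0 : ℝ) ≤ q (Matrix.single a b 1) := fun a b => NNReal.coe_nonneg _
    fin_cases j <;> simp <;> linarith [e 0 0, e 0 1, e 1 0, e 1 1]
  · rw [integral_add ((key 0).2.1.integrable (by norm_num))
      ((key 1).2.1.integrable (by norm_num)), (key 0).2.2.1, (key 1).2.2.1, add_zero]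

end

/-! ### The Itô equation along grids -/

section

variable {Ω : Type*} {mΩ : MeasurableSpace Ω} {μ : Measure Ω} {ℱ : Filtration ℝ≥0 mΩ}
  {B F : ℝ≥0 → Ω → Matrix (Fin 2) (Fin 2) ℝ} {q : Matrix (Fin 2) (Fin 2) ℝ → ℝ≥0}

/-- The uniform grid of step `δ`. -/
noncomputable def grid (δ : ℝ≥0) (k : ℕ) : ℝ≥0 := k * δ

lemma grid_mono (δ : ℝ≥0) : Monotone (grid δ) := fun a b hab => by
  unfold grid
  gcongr

lemma grid_succ_sub (δ : ℝ≥0) (k : ℕ) : (grid δ (k + 1) : ℝ) - grid δ k = δ := by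
  simp [grid]; ring

lemma grid_succ_tsub (δ : ℝ≥0) (k : ℕ) : grid δ (k + 1) - grid δ k = δ := by
  rw [← NNReal.coe_inj, NNReal.coe_sub (grid_mono δ k.le_succ), grid_succ_sub]

lemma grid_div_mul (h : ℝ≥0) {N : ℕ} (hN : N ≠ 0) (a : ℕ) : grid (h / N) (N * a) = grid h a := by
  have : (N : ℝ≥0) ≠ 0 := by exact_mod_cast hN
  unfold grid
  push_cast
  field_simp

lemma abs_entry_le_frobeniusNorm (A : Matrix (Fin 2) (Fin 2) ℝ) (i j : Fin 2) :
    |A i j| ≤ frobeniusNorm A := by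
  unfold frobeniusNorm
  rw [← Real.sqrt_sq_eq_abs]
  apply Real.sqrt_le_sqrt
  simp only [Matrix.trace_fin_two, Matrix.mul_apply, Fin.sum_univ_two, Matrix.transpose_apply]
  fin_cases i <;> fin_cases j <;> simp <;>
    nlinarith [sq_nonneg (A 0 0), sq_nonneg (A 0 1), sq_nonneg (A 1 0), sq_nonneg (A 1 1)]

/-- Convergence along all partitions specializes to the refinements of step `h / N` of the grid of
step `h`. At `N = 0` the grid degenerates, which does not matter for the limit. -/
lemma tendstoInMeasure_grid {S : ℕ → (ℕ → ℝ≥0) → Ω → Matrix (Fin 2) (Fin 2) ℝ}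
    {I : ℝ≥0 → Ω → Matrix (Fin 2) (Fin 2) ℝ} (hS : TendstoAlongPartitions μ S I) (h : ℝ≥0)
    (a : ℕ) (i j : Fin 2) :
    TendstoInMeasure μ (fun N ω => S (N * a) (grid (h / (N : ℝ≥0))) ω i j) atTop
      (fun ω => I (grid h a) ω i j) := by
  rw [tendstoInMeasure_iff_norm]
  intro ε hε
  rw [ENNReal.tendsto_atTop_zero]
  intro η hη
  obtain ⟨δ, hδ, hδ'⟩ := hS (grid h a) ε hε η hη
  obtain ⟨N₀, hN₀⟩ := exists_nat_gt (h / δ)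
  refine ⟨N₀ + 1, fun N hN => ?_⟩
  have hN0 : N ≠ 0 := by omega
  have hNp : (0 : ℝ≥0) < N := by exact_mod_cast Nat.pos_of_ne_zero hN0
  refine (measure_mono fun ω hω => ?_).trans
    (hδ' (N * a) (grid (h / N)) (grid_mono _) (by simp [grid]) (grid_div_mul h hN0 a) ?_)
  · simp only [Set.mem_ofPred_eq] at hω ⊢
    exact hω.trans (abs_entry_le_frobeniusNorm (S (N * a) (grid (h / N)) ω - I (grid h a) ω) i j)
  · intro k _
    rw [grid_succ_tsub]
    have : h / δ < N := hN₀.trans_le (by exact_mod_cast (by omega : N₀ ≤ N))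
    rw [div_le_iff₀ hNp]
    rw [div_lt_iff₀ hδ] at this
    rw [mul_comm]
    exact this.le

/-- A Riemann sum whose integrand is constant on blocks of length `N` is a Riemann sum over the
blocks. -/
lemma sum_block_telescope {R : Type*} [Ring R] (f b : ℕ → R) {N : ℕ} (hN : N ≠ 0) (c : ℕ) :
    ∑ k ∈ Finset.range (N * c), f (k / N) * (b (k + 1) - b k)
      = ∑ j ∈ Finset.range c, f j * (b (N * (j + 1)) - b (N * j)) := by
  induction c with
  | zero => simp
  | succ c ih =>
    rw [Nat.mul_succ, Finset.sum_range_add, ih, Finset.sum_range_succ]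
    congr 1
    have h1 : ∀ x ∈ Finset.range N, f ((N * c + x) / N) * (b (N * c + x + 1) - b (N * c + x))
        = f c * (b (N * c + (x + 1)) - b (N * c + x)) := by
      intro x hx
      rw [Nat.mul_add_div (Nat.pos_of_ne_zero hN), Nat.div_eq_of_lt (Finset.mem_range.1 hx)]
      rfl
    rw [Finset.sum_congr rfl h1, ← Finset.mul_sum,
      Finset.sum_range_sub (fun x => b (N * c + x)) N]
    rfl

namespace IsGeometricBrownianMotionSL

variable (hF : IsGeometricBrownianMotionSL μ ℱ B F)
include hF

lemma measurable_entry (t : ℝ≥0) (i j : Fin 2) : Measurable (fun ω => F t ω i j) :=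
  (hF.adapted t i j).mono (ℱ.le t) le_rfl

lemma measurable_driver_entry (t : ℝ≥0) (i j : Fin 2) : Measurable (fun ω => B t ω i j) :=
  (hF.driver.adapted t i j).mono (ℱ.le t) le_rfl

/-- `F` solves the driving equation in the sense of Itô as well. -/
lemma ito : IsItoIntegral μ F B (fun t ω => F t ω - F 0 ω) :=
  (hF.ito_eq_stratonovich _).1 hF.equation

lemma row_norm_sq (t : ℝ≥0) (i : Fin 2) :
    Integrable (fun ω => F t ω i 0 ^ 2 + F t ω i 1 ^ 2) μ ∧
      ∫ ω, F t ω i 0 ^ 2 + F t ω i 1 ^ 2 ∂μ = Real.exp t := by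
  have h := hF.normalization t i i
  simpa [Matrix.mul_apply, Fin.sum_univ_two, ← sq] using h

lemma secondMoment_entry (t : ℝ≥0) (i j : Fin 2) :
    SecondMomentLE μ (fun ω => F t ω i j) (Real.exp t) := by
  obtain ⟨h1, h2⟩ := row_norm_sq hF t i
  have hle : ∀ ω, F t ω i j ^ 2 ≤ F t ω i 0 ^ 2 + F t ω i 1 ^ 2 := by
    intro ω
    fin_cases j <;> simp <;> positivity
  have hm := measurable_entry hF t i j
  have hi : Integrable (fun ω => F t ω i j ^ 2) μ :=
    h1.mono' (hm.pow_const 2).aestronglyMeasurable (ae_of_all _ fun ω => by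
      rw [Real.norm_eq_abs, abs_of_nonneg (sq_nonneg _)]; exact hle ω)
  exact ⟨(memLp_two_iff_integrable_sq hm.aestronglyMeasurable).2 hi,
    (integral_mono hi h1 hle).trans_eq h2⟩

/-- The Itô equation between two points of a grid. -/
lemma tendstoInMeasure_ito (h : ℝ≥0) (a c : ℕ) (i j : Fin 2) :
    TendstoInMeasure μ (fun N ω => (∑ k ∈ Finset.range (N * c),
        F (grid (h / (N : ℝ≥0)) (N * a + k)) ω * (B (grid (h / (N : ℝ≥0)) (N * a + k + 1)) ω -
          B (grid (h / (N : ℝ≥0)) (N * a + k)) ω)) i j) atTop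
      (fun ω => (F (grid h (a + c)) ω - F (grid h a) ω) i j) := by
  have h1 := tendstoInMeasure_grid (ito hF) h (a + c) i j
  have h2 := tendstoInMeasure_grid (ito hF) h a i j
  have h3 := TendstoInMeasure.add_real h1 (TendstoInMeasure.const_mul_real h2 (-1))
  refine (h3.congr_left fun N => ae_of_all _ fun ω => ?_).congr_right (ae_of_all _ fun ω => ?_)
  · simp only [itoSum]
    rw [Nat.mul_add, Finset.sum_range_add]
    simp only [Matrix.add_apply]
    ring
  · simp only [Matrix.sub_apply]
    ring

variable [IsProbabilityMeasure μ] (hq : HasCovarianceForm μ B q)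
include hq

/-- The increments of `F` have second moments of the order of the time step, by the isometry and
the bound on the second moments of `F` in the normalization. -/
lemma secondMoment_incr {T : ℝ} (h : ℝ≥0) (a c : ℕ) (hT : (grid h (a + c) : ℝ) ≤ T)
    (i j : Fin 2) :
    SecondMomentLE μ (fun ω => (F (grid h (a + c)) ω - F (grid h a) ω) i j)
      (isometryConst q * Real.exp T * (c * h)) := by
  refine SecondMomentLE.of_tendstoInMeasure (tendstoInMeasure_ito hF h a c i j) ?_ ?_
    tendsto_const_nhds ?_
  · intro N
    have h1 := measurable_entry hF
    have h2 := measurable_driver_entry hF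
    simp only [Matrix.sum_apply, Matrix.mul_apply, Matrix.sub_apply]
    fun_prop
  · exact (measurable_entry hF _ i j).sub (measurable_entry hF _ i j)
  · filter_upwards [eventually_ne_atTop 0] with N hN
    have hN' : (N : ℝ) ≠ 0 := by exact_mod_cast hN
    have hmono : Monotone (fun k => grid (h / (N : ℝ≥0)) (N * a + k)) := fun x y hxy =>
      grid_mono _ (by omega)
    have key := (sum_mul_incr (hF.driver) hq (π := fun k => grid (h / (N : ℝ≥0)) (N * a + k))
      hmono (H := fun k => F (grid (h / (N : ℝ≥0)) (N * a + k)))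
      (fun k i j => hF.adapted _ i j) (fun k i j => (secondMoment_entry hF _ i j).1)
      (g := fun _ => Real.exp T) (N * c) (fun k hk i j => (secondMoment_entry hF _ i j).mono ?_)
      i j).1
    · refine key.mono (le_of_eq ?_)
      have : ∀ k, (grid (h / (N : ℝ≥0)) (N * a + (k + 1)) : ℝ) - grid (h / (N : ℝ≥0)) (N * a + k)
          = h / N := fun k => by
        rw [← add_assoc, grid_succ_sub]; simp
      simp only [this, Finset.sum_const, Finset.card_range, nsmul_eq_mul]
      push_cast
      field_simp
    · refine Real.exp_le_exp.2 (le_trans ?_ hT)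
      rw [← grid_div_mul h hN (a + c)]
      exact_mod_cast grid_mono _ (by rw [Nat.mul_add]; omega)

/-- The error of the Riemann sum of step `h` is of order `h` in second moment: on the refinement of
step `h / N`, it is itself a Riemann sum, with integrands that are increments of `F` over times at
most `h`. -/
lemma secondMoment_remainder {T : ℝ} (h : ℝ≥0) (a c : ℕ) (hT : (grid h (a + c) : ℝ) ≤ T)
    (i j : Fin 2) :
    SecondMomentLE μ (fun ω => (F (grid h (a + c)) ω - F (grid h a) ω -
        ∑ k ∈ Finset.range c, F (grid h (a + k)) ω *
          (B (grid h (a + k + 1)) ω - B (grid h (a + k)) ω)) i j)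
      (isometryConst q * (isometryConst q * Real.exp T * h) * (c * h)) := by
  have hK := isometryConst_nonneg q
  have hmE := measurable_entry hF
  have hmB := measurable_driver_entry hF
  have hlim := TendstoInMeasure.add_real (tendstoInMeasure_ito hF h a c i j)
    (tendstoInMeasure_const_real (μ := μ) (fun ω => -(∑ k ∈ Finset.range c, F (grid h (a + k)) ω *
          (B (grid h (a + k + 1)) ω - B (grid h (a + k)) ω)) i j))
  refine SecondMomentLE.of_tendstoInMeasure (hlim.congr_right (ae_of_all _ fun ω => ?_)) ?_ ?_
    tendsto_const_nhds ?_
  · simp only [Matrix.sub_apply]; ring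
  · intro N
    simp only [Matrix.sum_apply, Matrix.mul_apply, Matrix.sub_apply]
    fun_prop
  · simp only [Matrix.sum_apply, Matrix.mul_apply, Matrix.sub_apply]
    fun_prop
  · filter_upwards [eventually_ne_atTop 0] with N hN
    have hN' : (N : ℝ) ≠ 0 := by exact_mod_cast hN
    have hNpos := Nat.pos_of_ne_zero hN
    have hmono : Monotone (fun k => grid (h / (N : ℝ≥0)) (N * a + k)) := fun x y hxy =>
      grid_mono _ (by omega)
    have hdiv : ∀ k, N * (k / N) + k % N = k := fun k => Nat.div_add_mod k N
    have hH2 : ∀ k i j, MemLp (fun ω => (F (grid (h / (N : ℝ≥0)) (N * a + k)) ω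
        - F (grid h (a + k / N)) ω) i j) 2 μ := fun k i j =>
      (secondMoment_entry hF _ i j).1.sub (secondMoment_entry hF _ i j).1
    have key := (sum_mul_incr (hF.driver) hq (π := fun k => grid (h / (N : ℝ≥0)) (N * a + k))
      hmono (H := fun k ω => F (grid (h / (N : ℝ≥0)) (N * a + k)) ω - F (grid h (a + k / N)) ω)
      (fun k i j => (hF.adapted _ i j).sub ((hF.adapted _ i j).mono (ℱ.mono ?_) le_rfl)) hH2
      (g := fun _ => isometryConst q * Real.exp T * h) (N * c) (fun k hk i j => ?_)
      i j).1
    · refine (key.mono (le_of_eq ?_)).congr (ae_of_all _ fun ω => ?_)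
      · have : ∀ k, (grid (h / (N : ℝ≥0)) (N * a + (k + 1)) : ℝ)
            - grid (h / (N : ℝ≥0)) (N * a + k) = h / N := fun k => by
          rw [← add_assoc, grid_succ_sub]; simp
        simp only [this, Finset.sum_const, Finset.card_range, nsmul_eq_mul]
        push_cast
        field_simp
      · have h1 := sum_block_telescope (fun k => F (grid h (a + k)) ω)
          (fun k => B (grid (h / (N : ℝ≥0)) (N * a + k)) ω) hN c
        simp only [← Nat.mul_add, grid_div_mul h hN] at h1
        simp only [sub_mul, Finset.sum_sub_distrib, ← add_assoc] at h1 ⊢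
        rw [h1]
        simp only [Matrix.sub_apply, mul_sub]
        ring
    · rw [← grid_div_mul h hN]
      refine grid_mono _ ?_
      rw [Nat.mul_add]
      have := hdiv k
      omega
    · have h1 : N * (a + k / N) + k % N = N * a + k := by
        rw [Nat.mul_add, add_assoc, hdiv]
      have h2 := secondMoment_incr hF hq (T := T) (h / (N : ℝ≥0)) (N * (a + k / N)) (k % N) (by
        rw [h1]
        refine le_trans ?_ hT
        rw [← grid_div_mul h hN (a + c)]
        exact_mod_cast grid_mono _ (by rw [Nat.mul_add]; omega)) i j
      rw [h1, grid_div_mul h hN] at h2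
      refine h2.mono ?_
      have h3 : ((k % N : ℕ) : ℝ) ≤ N := by exact_mod_cast (Nat.mod_lt k hNpos).le
      have h4 : ((k % N : ℕ) : ℝ) * ((h / (N : ℝ≥0) : ℝ≥0) : ℝ) ≤ h := by
        rw [NNReal.coe_div, NNReal.coe_natCast, mul_div_assoc']
        rw [div_le_iff₀ (by exact_mod_cast hNpos), mul_comm (h : ℝ)]
        exact mul_le_mul_of_nonneg_right h3 h.2
      gcongr

end IsGeometricBrownianMotionSL

end

/-! ### Invariance and normalization of the covariance form -/

section

variable {Ω : Type*} {mΩ : MeasurableSpace Ω} {μ : Measure Ω} {ℱ : Filtration ℝ≥0 mΩ}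
  {B F : ℝ≥0 → Ω → Matrix (Fin 2) (Fin 2) ℝ} {q : Matrix (Fin 2) (Fin 2) ℝ → ℝ≥0}

/-- Comparison of leading coefficients at small times `s²`. -/
lemma eq_of_forall_abs_sq_mul_sub_le {x y C : ℝ}
    (h : ∀ s : ℝ≥0, s ≤ 1 → |(s : ℝ) ^ 2 * x - (s : ℝ) ^ 2 * y| ≤ C * (s : ℝ) ^ 3) : x = y := by
  have h1 : ∀ s : ℝ≥0, 0 < s → s ≤ 1 → |x - y| ≤ C * s := by
    intro s hs0 hs
    have h2 := h s hs
    have hs' : (0 : ℝ) < s := by exact_mod_cast hs0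
    rw [← mul_sub, abs_mul, abs_of_pos (by positivity : (0 : ℝ) < (s : ℝ) ^ 2)] at h2
    have h3 : (s : ℝ) ^ 2 * |x - y| ≤ (s : ℝ) ^ 2 * (C * s) := by linarith
    exact le_of_mul_le_mul_left h3 (by positivity)
  have h2 : Tendsto (fun n : ℕ => C * (((n : ℝ≥0) + 1)⁻¹ : ℝ≥0)) atTop (𝓝 (C * 0)) := by
    refine Tendsto.const_mul C ?_
    have := tendsto_one_div_add_atTop_nhds_zero_nat (𝕜 := ℝ)
    simpa using this
  have h3 : |x - y| ≤ C * 0 := ge_of_tendsto' h2 fun n => h1 _ (by positivity) (by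
    rw [inv_le_one₀ (by positivity)]; simp)
  rw [mul_zero] at h3
  exact sub_eq_zero.1 (abs_nonpos_iff.1 h3)

/-- `𝔼 g²` is close to `𝔼 f²` when `𝔼 (g - f)²` is small. -/
lemma abs_integral_sq_sub_le {f g : Ω → ℝ} {a b s : ℝ} (hf : SecondMomentLE μ f a)
    (hg : SecondMomentLE μ (fun ω => g ω - f ω) b) (hs : 0 < s) :
    |∫ ω, g ω ^ 2 ∂μ - ∫ ω, f ω ^ 2 ∂μ| ≤ 2 * (s * a + b / s) + b := by
  have hg' : MemLp g 2 μ :=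
    (hf.1.add hg.1).ae_eq (ae_of_all _ fun ω => by simp)
  have hi : Integrable (fun ω => |f ω * (g ω - f ω)|) μ := (hf.1.integrable_mul hg.1).abs
  rw [← integral_sub hg'.integrable_sq hf.1.integrable_sq]
  calc |∫ ω, g ω ^ 2 - f ω ^ 2 ∂μ| ≤ ∫ ω, |g ω ^ 2 - f ω ^ 2| ∂μ := abs_integral_le_integral_abs
    _ ≤ ∫ ω, (2 * |f ω * (g ω - f ω)| + (g ω - f ω) ^ 2) ∂μ := by
        refine integral_mono (hg'.integrable_sq.sub hf.1.integrable_sq).abs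
          ((hi.const_mul 2).add hg.1.integrable_sq) fun ω => ?_
        simp only
        rw [show g ω ^ 2 - f ω ^ 2 = 2 * (f ω * (g ω - f ω)) + (g ω - f ω) ^ 2 by ring]
        refine (abs_add_le _ _).trans ?_
        rw [abs_mul, abs_two, abs_of_nonneg (sq_nonneg (g ω - f ω))]
    _ = 2 * ∫ ω, |f ω * (g ω - f ω)| ∂μ + ∫ ω, (g ω - f ω) ^ 2 ∂μ := by
        rw [integral_add (hi.const_mul 2) hg.1.integrable_sq, integral_const_mul]
    _ ≤ _ := by
        have := integral_abs_mul_le hf hg hs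
        linarith [hg.2]

lemma sq_integral_le [IsProbabilityMeasure μ] {f : Ω → ℝ} {a : ℝ} (hf : SecondMomentLE μ f a) :
    (∫ ω, f ω ∂μ) ^ 2 ≤ a := by
  have h := variance_nonneg f μ
  rw [variance_eq_sub hf.1] at h
  have := hf.2
  simp only [Pi.pow_apply] at h
  linarith

lemma trace_mul_eq (M G : Matrix (Fin 2) (Fin 2) ℝ) : (M * G).trace =
    G 0 0 * M 0 0 + G 1 0 * M 0 1 + (G 0 1 * M 1 0 + G 1 1 * M 1 1) := by
  simp only [Matrix.trace_fin_two, Matrix.mul_apply, Fin.sum_univ_two]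
  ring

lemma SecondMomentLE.trace_mul {M : Ω → Matrix (Fin 2) (Fin 2) ℝ} {b : ℝ}
    (hM : ∀ i j, SecondMomentLE μ (fun ω => M ω i j) b) (G : Matrix (Fin 2) (Fin 2) ℝ) :
    SecondMomentLE μ (fun ω => (M ω * G).trace)
      (4 * (G 0 0 ^ 2 + G 1 0 ^ 2 + G 0 1 ^ 2 + G 1 1 ^ 2) * b) := by
  have h := (((hM 0 0).const_mul (G 0 0)).add ((hM 0 1).const_mul (G 1 0))).add
    (((hM 1 0).const_mul (G 0 1)).add ((hM 1 1).const_mul (G 1 1)))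
  simp only [trace_mul_eq]
  refine h.mono (le_of_eq ?_)
  ring

/-- The fourth moments of the increments are of the order of the square of the time step. -/
lemma HasCovarianceForm.secondMoment_mul_entry (hB : IsBrownianMotionSL μ ℱ B)
    (hq : HasCovarianceForm μ B q) :
    ∃ M : ℝ, 0 ≤ M ∧ ∀ s t : ℝ≥0, s ≤ t → t - s ≤ 1 → ∀ i j k l : Fin 2,
      SecondMomentLE μ (fun ω => (B t ω - B s ω) i j * (B t ω - B s ω) k l)
        (M * ((t : ℝ) - s) ^ 2) := by
  choose M hM0 hM using fun i j : Fin 2 =>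
    gaussian_moment_le μ (q (Matrix.single j i 1)) 4 0 0
  refine ⟨∑ i, ∑ j, ∑ k, ∑ l, (M i j + M k l), by
    refine Finset.sum_nonneg fun i _ => Finset.sum_nonneg fun j _ => Finset.sum_nonneg fun k _ =>
      Finset.sum_nonneg fun l _ => add_nonneg (hM0 _ _) (hM0 _ _), ?_⟩
  intro s t hst h1 i j k l
  have key : ∀ i j, Integrable (fun ω => (B t ω - B s ω) i j ^ 4) μ ∧
      ∫ ω, (B t ω - B s ω) i j ^ 4 ∂μ ≤ M i j * ((t : ℝ) - s) ^ 2 := by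
    intro i j
    have := hM i j (t - s) h1 _ (hq.hasLaw_entry hst i j)
    simp only [pow_zero, mul_one] at this
    have e : √((t - s : ℝ≥0) : ℝ) ^ 4 = ((t : ℝ) - s) ^ 2 := by
      rw [show 4 = 2 * 2 from rfl, pow_mul, Real.sq_sqrt (NNReal.coe_nonneg _),
        NNReal.coe_sub hst]
    rw [e] at this
    have e2 : ∀ x : ℝ, |x| ^ 4 = x ^ 4 := fun x => by
      rw [show 4 = 2 * 2 from rfl, pow_mul, pow_mul, sq_abs]
    simpa only [e2] using this
  have hm : ∀ i j, Measurable (fun ω => (B t ω - B s ω) i j) := fun i j =>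
    (IsBrownianMotionSL.measurable_incr_filtration hB hst i j).mono (ℱ.le t) le_rfl
  have hle : ∀ ω, ((B t ω - B s ω) i j * (B t ω - B s ω) k l) ^ 2 ≤
      (B t ω - B s ω) i j ^ 4 + (B t ω - B s ω) k l ^ 4 := fun ω => by
    nlinarith [sq_nonneg ((B t ω - B s ω) i j ^ 2 - (B t ω - B s ω) k l ^ 2),
      sq_nonneg ((B t ω - B s ω) i j ^ 2), sq_nonneg ((B t ω - B s ω) k l ^ 2)]
  have hint := (key i j).1.add (key k l).1
  have hsq : Integrable (fun ω => ((B t ω - B s ω) i j * (B t ω - B s ω) k l) ^ 2) μ :=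
    hint.mono' (((hm i j).mul (hm k l)).pow_const 2).aestronglyMeasurable
      (ae_of_all _ fun ω => by
        rw [Real.norm_eq_abs, abs_of_nonneg (sq_nonneg _)]; exact hle ω)
  refine ⟨(memLp_two_iff_integrable_sq ((hm i j).mul (hm k l)).aestronglyMeasurable).2 hsq, ?_⟩
  refine (integral_mono hsq hint hle).trans ?_
  have : ∫ ω, ((fun ω => (B t ω - B s ω) i j ^ 4) + fun ω => (B t ω - B s ω) k l ^ 4) ω ∂μ =
    _ := integral_add (key i j).1 (key k l).1
  rw [this]
  have h2 : M i j + M k l ≤ ∑ i, ∑ j, ∑ k, ∑ l, (M i j + M k l) := by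
    have p := fun i j k l => add_nonneg (hM0 i j) (hM0 k l)
    refine le_trans ?_ (Finset.single_le_sum (f := fun i => ∑ j, ∑ k, ∑ l, (M i j + M k l))
      (fun i _ => Finset.sum_nonneg fun j _ => Finset.sum_nonneg fun k _ =>
        Finset.sum_nonneg fun l _ => p i j k l) (Finset.mem_univ i))
    refine le_trans ?_ (Finset.single_le_sum (f := fun j => ∑ k, ∑ l, (M i j + M k l))
      (fun j _ => Finset.sum_nonneg fun k _ =>
        Finset.sum_nonneg fun l _ => p i j k l) (Finset.mem_univ j))
    refine le_trans ?_ (Finset.single_le_sum (f := fun k => ∑ l, (M i j + M k l))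
      (fun k _ => Finset.sum_nonneg fun l _ => p i j k l) (Finset.mem_univ k))
    exact Finset.single_le_sum (f := fun l => M i j + M k l)
      (fun l _ => p i j k l) (Finset.mem_univ l)
  calc _ ≤ M i j * ((t : ℝ) - s) ^ 2 + M k l * ((t : ℝ) - s) ^ 2 :=
        add_le_add (key i j).2 (key k l).2
    _ = (M i j + M k l) * ((t : ℝ) - s) ^ 2 := by ring
    _ ≤ _ := by gcongr

/-- The covariance form of a trace-free `B` is given by the covariances of three of its entries. -/
lemma HasCovarianceForm.exists_coeff [IsProbabilityMeasure μ] (hB : IsBrownianMotionSL μ ℱ B)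
    (hq : HasCovarianceForm μ B q) : ∃ A₁ A₂ A₃ A₁₂ A₁₃ A₂₃ : ℝ, ∀ G : Matrix (Fin 2) (Fin 2) ℝ,
      (q G : ℝ) = A₁ * (G 0 0 - G 1 1) ^ 2 + A₂ * G 1 0 ^ 2 + A₃ * G 0 1 ^ 2
        + 2 * A₁₂ * ((G 0 0 - G 1 1) * G 1 0) + 2 * A₁₃ * ((G 0 0 - G 1 1) * G 0 1)
        + 2 * A₂₃ * (G 1 0 * G 0 1) := by
  have h01 : (0 : ℝ≥0) ≤ 1 := zero_le_one
  set W : Fin 2 → Fin 2 → Ω → ℝ := fun i j ω => (B 1 ω - B 0 ω) i j with hW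
  have hL : ∀ i j, MemLp (W i j) 2 μ := fun i j => hq.memLp_two_entry h01 i j
  have hI : ∀ i j k l, Integrable (fun ω => W i j ω * W k l ω) μ := fun i j k l =>
    (hL i j).integrable_mul (hL k l)
  refine ⟨∫ ω, W 0 0 ω * W 0 0 ω ∂μ, ∫ ω, W 0 1 ω * W 0 1 ω ∂μ, ∫ ω, W 1 0 ω * W 1 0 ω ∂μ,
    ∫ ω, W 0 0 ω * W 0 1 ω ∂μ, ∫ ω, W 0 0 ω * W 1 0 ω ∂μ, ∫ ω, W 0 1 ω * W 1 0 ω ∂μ, fun G => ?_⟩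
  have h1 := hq.integral_sq h01 G
  rw [NNReal.coe_one, NNReal.coe_zero, sub_zero, one_mul] at h1
  rw [← h1]
  simp only [← integral_mul_const, ← integral_const_mul]
  rw [← integral_add, ← integral_add, ← integral_add, ← integral_add, ← integral_add]
  · refine integral_congr_ae ?_
    filter_upwards [hB.trace_zero 0, hB.trace_zero 1] with ω h0 h1
    rw [trace_mul_eq]
    rw [Matrix.trace_fin_two] at h0 h1
    have : (B 1 ω - B 0 ω) 1 1 = -(W 0 0 ω) := by
      simp only [hW, Matrix.sub_apply]; linarith
    rw [this]
    simp only [hW]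
    ring
  all_goals
    repeat' apply Integrable.add
    all_goals first
      | exact (hI _ _ _ _).mul_const _
      | exact ((hI _ _ _ _).const_mul _).mul_const _

namespace IsGeometricBrownianMotionSL

variable (hF : IsGeometricBrownianMotionSL μ ℱ B F) [IsProbabilityMeasure μ]
  (hq : HasCovarianceForm μ B q)
include hF hq

/-- `F` is a martingale, so its mean is constant. -/
lemma integral_entry (t : ℝ≥0) (i j : Fin 2) :
    ∫ ω, F t ω i j ∂μ = (1 : Matrix (Fin 2) (Fin 2) ℝ) i j := by
  have h0 : ∫ ω, F 0 ω i j ∂μ = (1 : Matrix (Fin 2) (Fin 2) ℝ) i j := by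
    rw [integral_congr_ae (g := fun _ => (1 : Matrix (Fin 2) (Fin 2) ℝ) i j)]
    · simp
    · filter_upwards [hF.initial] with ω hω
      rw [hω]
  have hi : ∀ s, Integrable (fun ω => F s ω i j) μ := fun s =>
    (secondMoment_entry hF s i j).1.integrable (by norm_num)
  have key : ∀ m : ℕ, m ≠ 0 → (∫ ω, F t ω i j ∂μ - ∫ ω, F 0 ω i j ∂μ) ^ 2 ≤
      (isometryConst q * (isometryConst q * Real.exp t) * t * t) * (1 / (m : ℝ)) := by
    intro m hm
    have hgt : grid (t / (m : ℝ≥0)) m = t := by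
      have := grid_div_mul t hm 1
      simpa [grid] using this
    have hg0 : grid (t / (m : ℝ≥0)) 0 = 0 := by simp [grid]
    have h1 := secondMoment_remainder hF hq (T := t) (t / (m : ℝ≥0)) 0 m
      (by rw [zero_add, hgt]) i j
    simp only [zero_add, hgt, hg0] at h1
    have h2 := sum_mul_incr hF.driver hq (grid_mono (t / (m : ℝ≥0)))
      (H := fun k => F (grid (t / (m : ℝ≥0)) k)) (fun k i j => hF.adapted _ i j)
      (fun k i j => (secondMoment_entry hF _ i j).1)
      (g := fun k => Real.exp (grid (t / (m : ℝ≥0)) k)) m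
      (fun k _ i j => secondMoment_entry hF _ i j) i j
    have h3 := sq_integral_le h1
    have h4 : ∫ ω, (F t ω - F 0 ω - ∑ k ∈ Finset.range m, F (grid (t / (m : ℝ≥0)) k) ω *
        (B (grid (t / (m : ℝ≥0)) (k + 1)) ω - B (grid (t / (m : ℝ≥0)) k) ω)) i j ∂μ
        = ∫ ω, F t ω i j ∂μ - ∫ ω, F 0 ω i j ∂μ := by
      simp only [Matrix.sub_apply (F t _ - F 0 _), Matrix.sub_apply (F t _)]
      have hsub : Integrable (fun ω => F t ω i j - F 0 ω i j) μ := (hi t).sub (hi 0)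
      rw [integral_sub hsub (h2.1.1.integrable (by norm_num)), h2.2, sub_zero,
        integral_sub (hi t) (hi 0)]
    rw [h4] at h3
    refine h3.trans (le_of_eq ?_)
    have hm' : (m : ℝ) ≠ 0 := by exact_mod_cast hm
    push_cast
    field_simp
  have hlim : Tendsto (fun m : ℕ => (isometryConst q * (isometryConst q * Real.exp t) * t * t)
      * (1 / (m : ℝ))) atTop (𝓝 (_ * 0)) :=
    tendsto_one_div_atTop_nhds_zero_nat.const_mul _
  have h5 := ge_of_tendsto hlim ((eventually_ne_atTop 0).mono key)
  rw [mul_zero] at h5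
  have h6 := pow_eq_zero_iff (two_ne_zero) |>.1 (le_antisymm h5 (sq_nonneg _))
  rw [← h0]
  linarith

/-- To leading order, the second moments of `F - 1` at small times are those of `B`. -/
lemma abs_integral_trace_sq_sub_le (G : Matrix (Fin 2) (Fin 2) ℝ) :
    ∃ C : ℝ, ∀ s : ℝ≥0, s ≤ 1 →
      |∫ ω, ((F (s ^ 2) ω - 1) * G).trace ^ 2 ∂μ - (s : ℝ) ^ 2 * q G| ≤ C * (s : ℝ) ^ 3 := by
  set K := isometryConst q
  set D : ℝ := 4 * (G 0 0 ^ 2 + G 1 0 ^ 2 + G 0 1 ^ 2 + G 1 1 ^ 2) * (K * (K * Real.exp 1))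
    with hD
  have hK : 0 ≤ K := isometryConst_nonneg q
  have hD0 : 0 ≤ D := by positivity
  refine ⟨2 * q G + 3 * D, fun s hs => ?_⟩
  rcases eq_or_ne s 0 with rfl | hs0
  · have : ∫ ω, ((F (0 ^ 2) ω - 1) * G).trace ^ 2 ∂μ = 0 := by
      rw [integral_congr_ae (g := fun _ => (0 : ℝ))]
      · simp
      · filter_upwards [hF.initial] with ω hω
        simp [hω]
    rw [this]; simp
  have hs0' : (0 : ℝ) < s := by exact_mod_cast pos_iff_ne_zero.2 hs0
  have hs1 : (s : ℝ) ≤ 1 := by exact_mod_cast hs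
  have hg1 : grid (s ^ 2) 1 = s ^ 2 := by simp [grid]
  have hg0 : grid (s ^ 2) 0 = 0 := by simp [grid]
  have hR : ∀ i j, SecondMomentLE μ (fun ω => ((F (s ^ 2) ω - 1) - (B (s ^ 2) ω - B 0 ω)) i j)
      (K * (K * Real.exp 1) * (s : ℝ) ^ 4) := by
    intro i j
    have h1 := secondMoment_remainder hF hq (T := 1) (s ^ 2) 0 1 (by
      rw [zero_add, hg1]; push_cast; exact pow_le_one₀ hs0'.le hs1) i j
    simp only [zero_add, Finset.sum_range_one, hg1, hg0] at h1
    refine (h1.mono (le_of_eq ?_)).congr ?_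
    · push_cast; ring
    · filter_upwards [hF.initial] with ω hω
      rw [hω, one_mul]
  have hR2 := SecondMomentLE.trace_mul hR G
  have hX : SecondMomentLE μ (fun ω => ((B (s ^ 2) ω - B 0 ω) * G).trace)
      ((s : ℝ) ^ 2 * q G) := by
    refine ⟨hq.memLp_two zero_le G, ?_⟩
    rw [hq.integral_sq zero_le]
    simp
  have h2 := abs_integral_sq_sub_le (g := fun ω => ((F (s ^ 2) ω - 1) * G).trace) hX
    (hR2.congr (ae_of_all _ fun ω => by simp only [sub_mul, Matrix.trace_sub])) hs0'
  rw [hq.integral_sq zero_le] at h2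
  have e : ((s ^ 2 : ℝ≥0) : ℝ) - (0 : ℝ≥0) = (s : ℝ) ^ 2 := by simp
  rw [e] at h2
  refine h2.trans ?_
  have h3 : 4 * (G 0 0 ^ 2 + G 1 0 ^ 2 + G 0 1 ^ 2 + G 1 1 ^ 2) *
      (K * (K * Real.exp 1) * (s : ℝ) ^ 4) = D * (s : ℝ) ^ 4 := by rw [hD]; ring
  rw [h3]
  have h4 : D * (s : ℝ) ^ 4 / s = D * (s : ℝ) ^ 3 := by field_simp
  rw [h4]
  have h5 : D * (s : ℝ) ^ 4 ≤ D * (s : ℝ) ^ 3 := by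
    refine mul_le_mul_of_nonneg_left ?_ hD0
    exact pow_le_pow_of_le_one hs0'.le hs1 (by norm_num)
  nlinarith

/-- The law of `B` inherits the invariance of the law of `F` under `O(2)`. -/
lemma covariance_conj (O : Matrix.orthogonalGroup (Fin 2) ℝ) (G : Matrix (Fin 2) (Fin 2) ℝ) :
    (q G : ℝ) = q ((O⁻¹ : Matrix.orthogonalGroup (Fin 2) ℝ) * G * O) := by
  obtain ⟨C₁, h1⟩ := abs_integral_trace_sq_sub_le hF hq G
  obtain ⟨C₂, h2⟩ := abs_integral_trace_sq_sub_le hF hq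
    ((O⁻¹ : Matrix.orthogonalGroup (Fin 2) ℝ) * G * O)
  have hO : (O : Matrix (Fin 2) (Fin 2) ℝ) * (O⁻¹ : Matrix.orthogonalGroup (Fin 2) ℝ) = 1 := by
    rw [← Submonoid.coe_mul, mul_inv_cancel]; rfl
  refine eq_of_forall_abs_sq_mul_sub_le (C := C₁ + C₂) fun s hs => ?_
  have hlaw : ∫ ω, ((F (s ^ 2) ω - 1) * ((O⁻¹ : Matrix.orthogonalGroup (Fin 2) ℝ) * G * O)).trace
      ^ 2 ∂μ = ∫ ω, ((F (s ^ 2) ω - 1) * G).trace ^ 2 ∂μ := by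
    have hm : Measurable (fun x : ℝ≥0 → Fin 2 → Fin 2 → ℝ =>
        ((Matrix.of (x (s ^ 2)) - 1) * G).trace ^ 2) := by
      simp only [trace_mul_eq, Matrix.sub_apply, Matrix.of_apply]
      fun_prop
    have h3 := ((hF.law_conj O).comp hm).integral_eq
    refine Eq.trans (integral_congr_ae (ae_of_all _ fun ω => ?_)) h3
    simp only [Function.comp]
    congr 1
    change _ = (((O : Matrix (Fin 2) (Fin 2) ℝ) * F (s ^ 2) ω *
        ((O⁻¹ : Matrix.orthogonalGroup (Fin 2) ℝ) : Matrix (Fin 2) (Fin 2) ℝ) - 1) * G).trace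
    have h5 : (O : Matrix (Fin 2) (Fin 2) ℝ) * F (s ^ 2) ω *
        ((O⁻¹ : Matrix.orthogonalGroup (Fin 2) ℝ) : Matrix (Fin 2) (Fin 2) ℝ) - 1
        = O * (F (s ^ 2) ω - 1) * (O⁻¹ : Matrix.orthogonalGroup (Fin 2) ℝ) := by
      rw [mul_sub, sub_mul, mul_one, hO]
    rw [h5, ← mul_assoc, Matrix.trace_mul_comm, mul_assoc (O : Matrix (Fin 2) (Fin 2) ℝ),
      mul_assoc (O : Matrix (Fin 2) (Fin 2) ℝ)]
    simp only [mul_assoc]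
  have h3 := h1 s hs
  have h4 := h2 s hs
  rw [hlaw] at h4
  rw [add_mul]
  have := abs_sub_le ((s : ℝ) ^ 2 * q G) (∫ ω, ((F (s ^ 2) ω - 1) * G).trace ^ 2 ∂μ)
    ((s : ℝ) ^ 2 * q ((O⁻¹ : Matrix.orthogonalGroup (Fin 2) ℝ) * G * O))
  rw [abs_sub_comm] at h3
  linarith

/-- The normalization of `F` fixes the size of the rows of `B`. -/
lemma covariance_row (i : Fin 2) :
    (q (Matrix.single 0 i 1) : ℝ) + q (Matrix.single 1 i 1) = 1 := by
  obtain ⟨C₁, h1⟩ := abs_integral_trace_sq_sub_le hF hq (Matrix.single 0 i 1)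
  obtain ⟨C₂, h2⟩ := abs_integral_trace_sq_sub_le hF hq (Matrix.single 1 i 1)
  -- Compare `𝔼 |row of F - 1|² = exp (s²) - 1` with `s²` to leading order.
  refine eq_of_forall_abs_sq_mul_sub_le (C := C₁ + C₂ + 1) fun s hs => ?_
  have hs1 : (s : ℝ) ≤ 1 := by exact_mod_cast hs
  have h3 := h1 s hs
  have h4 := h2 s hs
  simp only [trace_mul_single_two] at h3 h4
  have hint : ∀ i j, ∫ ω, (F (s ^ 2) ω - 1) i j ^ 2 ∂μ =
      ∫ ω, F (s ^ 2) ω i j ^ 2 ∂μ - (1 : Matrix (Fin 2) (Fin 2) ℝ) i j ^ 2 := by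
    intro i j
    have hm := (secondMoment_entry hF (s ^ 2) i j).1
    have e : ∀ ω, (F (s ^ 2) ω - 1) i j ^ 2 = F (s ^ 2) ω i j ^ 2
        - (2 * (1 : Matrix (Fin 2) (Fin 2) ℝ) i j * F (s ^ 2) ω i j
          - (1 : Matrix (Fin 2) (Fin 2) ℝ) i j ^ 2) := fun ω => by
      rw [Matrix.sub_apply]; ring
    have hi1 := (hm.integrable (by norm_num)).const_mul (2 * (1 : Matrix (Fin 2) (Fin 2) ℝ) i j)
    have hi2 : Integrable (fun ω => 2 * (1 : Matrix (Fin 2) (Fin 2) ℝ) i j * F (s ^ 2) ω i j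
        - (1 : Matrix (Fin 2) (Fin 2) ℝ) i j ^ 2) μ := hi1.sub (integrable_const _)
    simp only [e]
    rw [integral_sub hm.integrable_sq hi2,
      integral_sub hi1 (integrable_const _), integral_const_mul, integral_entry hF hq]
    simp
    ring
  have hexp : ∫ ω, (F (s ^ 2) ω - 1) i 0 ^ 2 ∂μ + ∫ ω, (F (s ^ 2) ω - 1) i 1 ^ 2 ∂μ
      = Real.exp ((s : ℝ) ^ 2) - 1 := by
    have h5 := (row_norm_sq hF (s ^ 2) i).2
    rw [integral_add (secondMoment_entry hF _ _ _).1.integrable_sq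
      (secondMoment_entry hF _ _ _).1.integrable_sq] at h5
    have e : ∀ i, (1 : Matrix (Fin 2) (Fin 2) ℝ) i 0 ^ 2 + (1 : Matrix (Fin 2) (Fin 2) ℝ) i 1 ^ 2
        = 1 := Fin.forall_fin_two.2 ⟨by simp, by simp⟩
    have e := e i
    push_cast at h5
    rw [hint, hint]
    linarith
  have h6 : |Real.exp ((s : ℝ) ^ 2) - 1 - (s : ℝ) ^ 2| ≤ ((s : ℝ) ^ 2) ^ 2 :=
    Real.abs_exp_sub_one_sub_id_le (by
      rw [abs_of_nonneg (by positivity)]; exact pow_le_one₀ s.2 hs1)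
  have h7 : ((s : ℝ) ^ 2) ^ 2 ≤ (s : ℝ) ^ 3 := by
    rw [← pow_mul]
    exact pow_le_pow_of_le_one s.2 hs1 (by norm_num)
  rw [abs_le] at h3 h4 h6 ⊢
  constructor <;> nlinarith

end IsGeometricBrownianMotionSL

end

/-! ### Vanishing of the Itô correction and the covariance form -/

section

variable {Ω : Type*} {mΩ : MeasurableSpace Ω} {μ : Measure Ω} {ℱ : Filtration ℝ≥0 mΩ}
  {B F : ℝ≥0 → Ω → Matrix (Fin 2) (Fin 2) ℝ} {q : Matrix (Fin 2) (Fin 2) ℝ → ℝ≥0}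

/-- The upper left entry of `𝔼 B₁²`, written in terms of the covariance form by polarization. As
`B` is trace-free, `B₁²` is a multiple of the identity. -/
noncomputable def meanSquare (q : Matrix (Fin 2) (Fin 2) ℝ → ℝ≥0) : ℝ :=
  q (Matrix.single 0 0 1) + ((q (Matrix.single 1 0 1 + Matrix.single 0 1 1) : ℝ)
    - q (Matrix.single 1 0 1) - q (Matrix.single 0 1 1)) / 2

lemma HasCovarianceForm.integral_mul_self [IsProbabilityMeasure μ] (hq : HasCovarianceForm μ B q)
    {s t : ℝ≥0} (hst : s ≤ t) :
    ∫ ω, ((B t ω - B s ω) 0 0 * (B t ω - B s ω) 0 0 + (B t ω - B s ω) 0 1 * (B t ω - B s ω) 1 0) ∂μ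
      = (t - s) * meanSquare q := by
  have h1 := hq.integral_sq hst (Matrix.single 1 0 1 + Matrix.single 0 1 1)
  simp only [mul_add, Matrix.trace_add, trace_mul_single_two] at h1
  have m01 := hq.memLp_two_entry hst 0 1
  have m10 := hq.memLp_two_entry hst 1 0
  have m00 := hq.memLp_two_entry hst 0 0
  have e : ∀ ω, (B t ω - B s ω) 0 0 * (B t ω - B s ω) 0 0
      + (B t ω - B s ω) 0 1 * (B t ω - B s ω) 1 0
      = (B t ω - B s ω) 0 0 ^ 2 + (1 / 2) * (((B t ω - B s ω) 0 1 + (B t ω - B s ω) 1 0) ^ 2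
        - ((B t ω - B s ω) 0 1 ^ 2 + (B t ω - B s ω) 1 0 ^ 2)) := fun ω => by ring
  have i1 : Integrable (fun ω => ((B t ω - B s ω) 0 1 + (B t ω - B s ω) 1 0) ^ 2) μ :=
    (m01.add m10).integrable_sq
  have i2 : Integrable (fun ω => (B t ω - B s ω) 0 1 ^ 2 + (B t ω - B s ω) 1 0 ^ 2) μ :=
    m01.integrable_sq.add m10.integrable_sq
  have i3 : Integrable (fun ω => (1 / 2 : ℝ) * (((B t ω - B s ω) 0 1 + (B t ω - B s ω) 1 0) ^ 2
        - ((B t ω - B s ω) 0 1 ^ 2 + (B t ω - B s ω) 1 0 ^ 2))) μ := (i1.sub i2).const_mul _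
  simp only [e]
  rw [integral_add m00.integrable_sq i3, integral_const_mul, integral_sub i1 i2,
    integral_add m01.integrable_sq m10.integrable_sq, h1, hq.integral_entry_sq hst,
    hq.integral_entry_sq hst, hq.integral_entry_sq hst, meanSquare]
  ring

namespace IsGeometricBrownianMotionSL

variable (hF : IsGeometricBrownianMotionSL μ ℱ B F)
include hF

/-- The sums `∑ ΔF ΔB`, which are twice the differences of the Stratonovich and the Itô sums, tend
to zero. -/
lemma tendstoInMeasure_quadratic_covariation (t : ℝ≥0) :
    TendstoInMeasure μ (fun N ω => (∑ k ∈ Finset.range N,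
        (F (grid (t / (N : ℝ≥0)) (k + 1)) ω - F (grid (t / (N : ℝ≥0)) k) ω) *
          (B (grid (t / (N : ℝ≥0)) (k + 1)) ω - B (grid (t / (N : ℝ≥0)) k) ω)) 0 0) atTop
      (fun _ => 0) := by
  have h1 := tendstoInMeasure_grid hF.equation t 1 0 0
  have h2 := tendstoInMeasure_grid (ito hF) t 1 0 0
  have h3 := TendstoInMeasure.const_mul_real
    (TendstoInMeasure.add_real h1 (TendstoInMeasure.const_mul_real h2 (-1))) 2
  refine (h3.congr_left fun N => ae_of_all _ fun ω => ?_).congr_right (ae_of_all _ fun ω => ?_)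
  · simp only [stratonovichSum, itoSum, mul_one]
    rw [neg_one_mul, ← sub_eq_add_neg, ← Matrix.sub_apply, ← Finset.sum_sub_distrib,
      ← smul_eq_mul, ← Matrix.smul_apply, Finset.smul_sum]
    refine congrFun (congrFun (Finset.sum_congr rfl fun k _ => ?_) 0) 0
    rw [← sub_mul, ← smul_mul_assoc]
    congr 1
    rw [smul_sub, smul_smul]
    norm_num
    rw [two_smul]
    abel
  · simp only []
    ring

variable [IsProbabilityMeasure μ] (hq : HasCovarianceForm μ B q)
include hq

/-- In `∑ ΔF ΔB`, the increment `ΔF` may be replaced by `F ΔB`. -/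
lemma tendstoInMeasure_remainder_mul_incr {t : ℝ≥0} (ht : t ≤ 1) :
    TendstoInMeasure μ (fun N ω => (∑ k ∈ Finset.range N,
        (F (grid (t / (N : ℝ≥0)) (k + 1)) ω - F (grid (t / (N : ℝ≥0)) k) ω
          - F (grid (t / (N : ℝ≥0)) k) ω *
            (B (grid (t / (N : ℝ≥0)) (k + 1)) ω - B (grid (t / (N : ℝ≥0)) k) ω)) *
          (B (grid (t / (N : ℝ≥0)) (k + 1)) ω - B (grid (t / (N : ℝ≥0)) k) ω)) 0 0) atTop
      (fun _ => 0) := by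
  set K := isometryConst q
  set D : ℝ := K * (K * Real.exp 1) with hD
  set v : ℝ := q (Matrix.single 0 0 1) + q (Matrix.single 0 1 1) with hv
  have hgle : ∀ (N k : ℕ), grid (t / (N : ℝ≥0)) k ≤ grid (t / (N : ℝ≥0)) (k + 1) :=
    fun N k => grid_mono _ k.le_succ
  have hR : ∀ N : ℕ, ∀ k < N, ∀ i j, SecondMomentLE μ (fun ω =>
      (F (grid (t / (N : ℝ≥0)) (k + 1)) ω - F (grid (t / (N : ℝ≥0)) k) ω
          - F (grid (t / (N : ℝ≥0)) k) ω *
            (B (grid (t / (N : ℝ≥0)) (k + 1)) ω - B (grid (t / (N : ℝ≥0)) k) ω)) i j)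
      (D * ((t : ℝ) / N) ^ 2) := by
    intro N k hk i j
    have hN : N ≠ 0 := by omega
    have h1 := secondMoment_remainder hF hq (T := 1) (t / (N : ℝ≥0)) k 1 (by
      have h2 : grid (t / (N : ℝ≥0)) (k + 1) ≤ grid t 1 := by
        rw [← grid_div_mul t hN 1]; exact grid_mono _ (by omega)
      refine le_trans (b := (t : ℝ)) ?_ (by exact_mod_cast ht)
      exact_mod_cast h2.trans (by simp [grid])) i j
    simp only [Finset.sum_range_one, add_zero] at h1
    refine h1.mono (le_of_eq ?_)
    push_cast
    rw [hD]
    ring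
  have hB2 : ∀ (N k : ℕ) l, SecondMomentLE μ (fun ω =>
      (B (grid (t / (N : ℝ≥0)) (k + 1)) ω - B (grid (t / (N : ℝ≥0)) k) ω) l 0)
      (v * ((t : ℝ) / N)) := by
    intro N k l
    refine ⟨hq.memLp_two_entry (hgle N k) l 0, ?_⟩
    rw [hq.integral_entry_sq (hgle N k), grid_succ_sub]
    push_cast
    rw [mul_comm]
    refine mul_le_mul_of_nonneg_right ?_ (by positivity)
    rw [hv]
    fin_cases l <;> simp
  have e : ∀ N ω, (∑ k ∈ Finset.range N,
        (F (grid (t / (N : ℝ≥0)) (k + 1)) ω - F (grid (t / (N : ℝ≥0)) k) ω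
          - F (grid (t / (N : ℝ≥0)) k) ω *
            (B (grid (t / (N : ℝ≥0)) (k + 1)) ω - B (grid (t / (N : ℝ≥0)) k) ω)) *
          (B (grid (t / (N : ℝ≥0)) (k + 1)) ω - B (grid (t / (N : ℝ≥0)) k) ω)) 0 0 =
      ∑ k ∈ Finset.range N, ∑ l, (F (grid (t / (N : ℝ≥0)) (k + 1)) ω
          - F (grid (t / (N : ℝ≥0)) k) ω - F (grid (t / (N : ℝ≥0)) k) ω *
            (B (grid (t / (N : ℝ≥0)) (k + 1)) ω - B (grid (t / (N : ℝ≥0)) k) ω)) 0 l *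
          (B (grid (t / (N : ℝ≥0)) (k + 1)) ω - B (grid (t / (N : ℝ≥0)) k) ω) l 0 := fun N ω => by
    rw [Matrix.sum_apply]
    simp only [Matrix.mul_apply]
  simp only [e]
  have hi : ∀ N : ℕ, ∀ k < N, ∀ l, Integrable (fun ω => (F (grid (t / (N : ℝ≥0)) (k + 1)) ω
          - F (grid (t / (N : ℝ≥0)) k) ω - F (grid (t / (N : ℝ≥0)) k) ω *
            (B (grid (t / (N : ℝ≥0)) (k + 1)) ω - B (grid (t / (N : ℝ≥0)) k) ω)) 0 l *
          (B (grid (t / (N : ℝ≥0)) (k + 1)) ω - B (grid (t / (N : ℝ≥0)) k) ω) l 0) μ :=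
    fun N k hk l => (hR N k hk 0 l).1.integrable_mul (hB2 N k l).1
  refine tendstoInMeasure_of_integral_abs_le (c := fun N : ℕ => 2 * t * (D + v) * √((t : ℝ) / N))
    (fun N => integrable_finsetSum _ fun k hk => integrable_finsetSum _ fun l _ =>
      hi N k (Finset.mem_range.1 hk) l) ?_ ?_
  · have h1 : Tendsto (fun N : ℕ => √((t : ℝ) / N)) atTop (𝓝 (√0)) :=
      (Real.continuous_sqrt.tendsto 0).comp (tendsto_const_div_atTop_nhds_zero_nat _)
    simpa using h1.const_mul (2 * (t : ℝ) * (D + v))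
  · filter_upwards [eventually_ne_atTop 0] with N hN
    have hNp : (0 : ℝ) < N := by exact_mod_cast Nat.pos_of_ne_zero hN
    rcases eq_or_ne t 0 with rfl | ht0
    · simp [grid]
    have htp : (0 : ℝ) < t := by exact_mod_cast pos_iff_ne_zero.2 ht0
    set h : ℝ := (t : ℝ) / N with hh
    have hhp : 0 < h := div_pos htp hNp
    have hsq : √h * √h = h := Real.mul_self_sqrt hhp.le
    have hsp : 0 < √h := Real.sqrt_pos.2 hhp
    have hone : ∀ k < N, ∀ l, ∫ ω, |(F (grid (t / (N : ℝ≥0)) (k + 1)) ω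
          - F (grid (t / (N : ℝ≥0)) k) ω - F (grid (t / (N : ℝ≥0)) k) ω *
            (B (grid (t / (N : ℝ≥0)) (k + 1)) ω - B (grid (t / (N : ℝ≥0)) k) ω)) 0 l *
          (B (grid (t / (N : ℝ≥0)) (k + 1)) ω - B (grid (t / (N : ℝ≥0)) k) ω) l 0| ∂μ
        ≤ (D + v) * (h * √h) := by
      intro k hk l
      have h1 := integral_abs_mul_le (hR N k hk 0 l) (hB2 N k l) (s := (√h)⁻¹) (inv_pos.2 hsp)
      refine h1.trans (le_of_eq ?_)
      rw [← hh, div_inv_eq_mul]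
      have : (√h)⁻¹ * (D * h ^ 2) = D * (h * √h) := by
        have h2 : h ^ 2 = √h * (h * √h) := by
          calc h ^ 2 = h * h := sq h
            _ = h * (√h * √h) := by rw [hsq]
            _ = _ := by ring
        rw [h2]
        field_simp
      rw [this]
      ring
    calc ∫ ω, |∑ k ∈ Finset.range N, ∑ l, (F (grid (t / (N : ℝ≥0)) (k + 1)) ω
          - F (grid (t / (N : ℝ≥0)) k) ω - F (grid (t / (N : ℝ≥0)) k) ω *
            (B (grid (t / (N : ℝ≥0)) (k + 1)) ω - B (grid (t / (N : ℝ≥0)) k) ω)) 0 l *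
          (B (grid (t / (N : ℝ≥0)) (k + 1)) ω - B (grid (t / (N : ℝ≥0)) k) ω) l 0| ∂μ
        ≤ ∫ ω, ∑ k ∈ Finset.range N, ∑ l, |(F (grid (t / (N : ℝ≥0)) (k + 1)) ω
          - F (grid (t / (N : ℝ≥0)) k) ω - F (grid (t / (N : ℝ≥0)) k) ω *
            (B (grid (t / (N : ℝ≥0)) (k + 1)) ω - B (grid (t / (N : ℝ≥0)) k) ω)) 0 l *
          (B (grid (t / (N : ℝ≥0)) (k + 1)) ω - B (grid (t / (N : ℝ≥0)) k) ω) l 0| ∂μ := by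
          refine integral_mono (integrable_finsetSum _ fun k hk => integrable_finsetSum _ fun l _ =>
            hi N k (Finset.mem_range.1 hk) l).abs (integrable_finsetSum _ fun k hk =>
            integrable_finsetSum _ fun l _ => (hi N k (Finset.mem_range.1 hk) l).abs) fun ω => ?_
          exact (Finset.abs_sum_le_sum_abs _ _).trans
            (Finset.sum_le_sum fun k _ => Finset.abs_sum_le_sum_abs _ _)
      _ = ∑ k ∈ Finset.range N, ∑ l, ∫ ω, |(F (grid (t / (N : ℝ≥0)) (k + 1)) ω
          - F (grid (t / (N : ℝ≥0)) k) ω - F (grid (t / (N : ℝ≥0)) k) ω *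
            (B (grid (t / (N : ℝ≥0)) (k + 1)) ω - B (grid (t / (N : ℝ≥0)) k) ω)) 0 l *
          (B (grid (t / (N : ℝ≥0)) (k + 1)) ω - B (grid (t / (N : ℝ≥0)) k) ω) l 0| ∂μ := by
          rw [integral_finsetSum _ fun k hk => integrable_finsetSum _ fun l _ =>
            (hi N k (Finset.mem_range.1 hk) l).abs]
          refine Finset.sum_congr rfl fun k hk => ?_
          rw [integral_finsetSum _ fun l _ => (hi N k (Finset.mem_range.1 hk) l).abs]
      _ ≤ ∑ k ∈ Finset.range N, ∑ l : Fin 2, (D + v) * (h * √h) :=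
          Finset.sum_le_sum fun k hk => Finset.sum_le_sum fun l _ =>
            hone k (Finset.mem_range.1 hk) l
      _ = _ := by
          simp only [Finset.sum_const, Finset.card_range, Finset.card_univ, Fintype.card_fin,
            nsmul_eq_mul]
          have : (N : ℝ) * h = t := by rw [hh]; field_simp
          rw [← this]
          push_cast
          ring

/-- In `∑ F (ΔB)²`, the scalar `(ΔB)²` may be replaced by its mean. -/
lemma tendstoInMeasure_sum_mul_centred {t : ℝ≥0} (ht : t ≤ 1) :
    TendstoInMeasure μ (fun N ω => ∑ k ∈ Finset.range N, F (grid (t / (N : ℝ≥0)) k) ω 0 0 *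
      ((B (grid (t / (N : ℝ≥0)) (k + 1)) ω - B (grid (t / (N : ℝ≥0)) k) ω) 0 0 *
        (B (grid (t / (N : ℝ≥0)) (k + 1)) ω - B (grid (t / (N : ℝ≥0)) k) ω) 0 0 +
      (B (grid (t / (N : ℝ≥0)) (k + 1)) ω - B (grid (t / (N : ℝ≥0)) k) ω) 0 1 *
        (B (grid (t / (N : ℝ≥0)) (k + 1)) ω - B (grid (t / (N : ℝ≥0)) k) ω) 1 0 -
      (t / (N : ℝ)) * meanSquare q)) atTop (fun _ => 0) := by
  obtain ⟨M, hM0, hM⟩ := HasCovarianceForm.secondMoment_mul_entry hF.driver hq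
  set D : ℝ := 8 * M + 2 * meanSquare q ^ 2 with hD
  have hgle : ∀ (N k : ℕ), grid (t / (N : ℝ≥0)) k ≤ grid (t / (N : ℝ≥0)) (k + 1) :=
    fun N k => grid_mono _ k.le_succ
  set β : ℕ → ℕ → Ω → ℝ := fun N k ω =>
    (B (grid (t / (N : ℝ≥0)) (k + 1)) ω - B (grid (t / (N : ℝ≥0)) k) ω) 0 0 *
        (B (grid (t / (N : ℝ≥0)) (k + 1)) ω - B (grid (t / (N : ℝ≥0)) k) ω) 0 0 +
      (B (grid (t / (N : ℝ≥0)) (k + 1)) ω - B (grid (t / (N : ℝ≥0)) k) ω) 0 1 *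
        (B (grid (t / (N : ℝ≥0)) (k + 1)) ω - B (grid (t / (N : ℝ≥0)) k) ω) 1 0 -
      (t / (N : ℝ)) * meanSquare q with hβ
  have hstep1 : ∀ N : ℕ, t / (N : ℝ≥0) ≤ 1 := fun N => by
    rcases Nat.eq_zero_or_pos N with rfl | hN
    · simp
    · rw [div_le_one (by exact_mod_cast hN)]
      exact ht.trans (by exact_mod_cast hN)
  have hβ2 : ∀ N k, SecondMomentLE μ (β N k) (D * ((t : ℝ) / N) ^ 2) := by
    intro N k
    have hs : grid (t / (N : ℝ≥0)) (k + 1) - grid (t / (N : ℝ≥0)) k ≤ 1 := by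
      rw [grid_succ_tsub]; exact hstep1 N
    have h1 := ((hM _ _ (hgle N k) hs 0 0 0 0).add (hM _ _ (hgle N k) hs 0 1 1 0)).sub
      (g := fun _ => (t / (N : ℝ)) * meanSquare q) (b := ((t / (N : ℝ)) * meanSquare q) ^ 2)
      ⟨memLp_const _, by simp⟩
    refine h1.mono (le_of_eq ?_)
    rw [grid_succ_sub, hD]
    push_cast
    ring
  have hβ0 : ∀ N k, ∫ ω, β N k ω ∂μ = 0 := by
    intro N k
    have h1 := hq.integral_mul_self (hgle N k)
    rw [grid_succ_sub] at h1
    push_cast at h1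
    have hL := fun i j => hq.memLp_two_entry (hgle N k) i j
    have hi := ((hL 0 0).integrable_mul (hL 0 0)).add ((hL 0 1).integrable_mul (hL 1 0))
    have h2 := integral_sub hi (integrable_const (μ := μ) ((t / (N : ℝ)) * meanSquare q))
    refine h2.trans ?_
    simp only [Pi.add_apply, Pi.mul_apply]
    rw [h1]
    simp
  refine SecondMomentLE.tendstoInMeasure (c := fun N : ℕ => Real.exp 1 * D * t ^ 2 * (1 / (N : ℝ)))
    ?_ ?_
  · simpa using (tendsto_one_div_atTop_nhds_zero_nat (𝕜 := ℝ)).const_mul (Real.exp 1 * D * t ^ 2)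
  · filter_upwards [eventually_ne_atTop 0] with N hN
    have hNp : (0 : ℝ) < N := by exact_mod_cast Nat.pos_of_ne_zero hN
    have key := isometry_sum_mul (μ := μ) (𝒢 := fun k => ℱ (grid (t / (N : ℝ≥0)) k))
      (fun a b hab => ℱ.mono (grid_mono _ hab))
      (G := fun k ω => F (grid (t / (N : ℝ≥0)) k) ω 0 0) (ξ := β N)
      (fun k => hF.adapted _ 0 0) (fun k => (secondMoment_entry hF _ 0 0).1)
      (fun k => by
        have hm := fun i j => IsBrownianMotionSL.measurable_incr_filtration hF.driver (hgle N k) i j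
        exact (((hm 0 0).mul (hm 0 0)).add ((hm 0 1).mul (hm 1 0))).sub_const _)
      (fun k => (hβ2 N k).1)
      (fun k => IsBrownianMotionSL.indep_comp hF.driver (hgle N k)
        (f := fun x => x 0 0 * x 0 0 + x 0 1 * x 1 0 - (t / (N : ℝ)) * meanSquare q)
        (by fun_prop))
      (hβ0 N) N
    simp only [sub_zero]
    refine ⟨key.2.1, key.2.2.2.le.trans ?_⟩
    calc ∑ k ∈ Finset.range N, (∫ ω, F (grid (t / (N : ℝ≥0)) k) ω 0 0 ^ 2 ∂μ) *
          ∫ ω, β N k ω ^ 2 ∂μ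
        ≤ ∑ k ∈ Finset.range N, Real.exp 1 * (D * ((t : ℝ) / N) ^ 2) := by
          refine Finset.sum_le_sum fun k hk => mul_le_mul ?_ (hβ2 N k).2
            (integral_nonneg fun _ => sq_nonneg _) (Real.exp_pos 1).le
          refine (secondMoment_entry hF _ 0 0).2.trans (Real.exp_le_exp.2 ?_)
          have h2 : grid (t / (N : ℝ≥0)) k ≤ grid t 1 := by
            rw [← grid_div_mul t hN 1]
            exact grid_mono _ (by have := Finset.mem_range.1 hk; omega)
          have h3 : grid t 1 ≤ 1 := by simpa [grid] using ht
          exact_mod_cast h2.trans h3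
      _ = _ := by
          simp only [Finset.sum_const, Finset.card_range, nsmul_eq_mul]
          field_simp

/-- The agreement of the Itô and the Stratonovich interpretation of `F dB` forces `𝔼 B₁² = 0`. -/
theorem meanSquare_eq_zero : meanSquare q = 0 := by
  set K := isometryConst q with hK
  have hK0 : 0 ≤ K := isometryConst_nonneg q
  set D : ℝ := K * Real.exp 1 with hD
  have hD0 : 0 ≤ D := by positivity
  -- For such `t`, `F` stays so close to `1` on `[0, t]` that `∫₀ᵗ F ≠ 0`.
  obtain ⟨t, ht0, ht1, htD⟩ : ∃ t : ℝ≥0, 0 < t ∧ t ≤ 1 ∧ D * t < 1 := by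
    have hpos : 0 < 1 / (D + 1) := by positivity
    refine ⟨(1 / (D + 1)).toNNReal, Real.toNNReal_pos.2 hpos, Real.toNNReal_le_one.2 ?_, ?_⟩
    · rw [div_le_one (by positivity)]; linarith
    · rw [Real.coe_toNNReal _ hpos.le, mul_one_div, div_lt_one (by positivity)]; linarith
  have htp : (0 : ℝ) < t := by exact_mod_cast ht0
  set κ := meanSquare q with hκ
  have hQ := tendstoInMeasure_quadratic_covariation hF t
  have h1 := tendstoInMeasure_remainder_mul_incr hF hq ht1
  have h2 := tendstoInMeasure_sum_mul_centred hF hq ht1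
  have h3 := TendstoInMeasure.add_real (TendstoInMeasure.add_real hQ
    (TendstoInMeasure.const_mul_real (TendstoInMeasure.add_real h1 h2) (-1)))
    (tendstoInMeasure_const_real (μ := μ) (fun _ => -(κ * t)))
  simp only [add_zero, mul_zero, zero_add] at h3
  have htr : ∀ᵐ ω ∂μ, ∀ N k : ℕ, (B (grid (t / (N : ℝ≥0)) k) ω).trace = 0 := by
    simp only [ae_all_iff]
    exact fun N k => hF.driver.trace_zero _
  have h4 : TendstoInMeasure μ (fun (N : ℕ) ω => (κ * (t / N)) *
      ∑ k ∈ Finset.range N, (F (grid (t / (N : ℝ≥0)) k) ω 0 0 - 1)) atTop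
      (fun _ => -(κ * t)) := by
    refine h3.congr' ?_ (ae_of_all _ fun _ => rfl)
    filter_upwards [eventually_ne_atTop 0] with N hN
    have hN' : (N : ℝ) ≠ 0 := by exact_mod_cast hN
    filter_upwards [htr] with ω hω
    have e1 : κ * (t : ℝ) = ∑ k ∈ Finset.range N, κ * (t / N) := by
      simp only [Finset.sum_const, Finset.card_range, nsmul_eq_mul]
      field_simp
    rw [e1, Matrix.sum_apply, Matrix.sum_apply, ← Finset.sum_add_distrib, Finset.mul_sum,
      Finset.mul_sum, ← Finset.sum_add_distrib, ← sub_eq_add_neg, ← Finset.sum_sub_distrib]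
    refine Finset.sum_congr rfl fun k _ => ?_
    have t0 := hω N k
    have t1 := hω N (k + 1)
    rw [Matrix.trace_fin_two] at t0 t1
    simp only [Matrix.mul_apply, Fin.sum_univ_two, Matrix.sub_apply]
    have e2 : B (grid (t / (N : ℝ≥0)) k) ω 1 1 = - B (grid (t / (N : ℝ≥0)) k) ω 0 0 := by linarith
    have e3 : B (grid (t / (N : ℝ≥0)) (k + 1)) ω 1 1
      = - B (grid (t / (N : ℝ≥0)) (k + 1)) ω 0 0 := by linarith
    rw [e2, e3]
    ring
  have h5 : SecondMomentLE μ (fun _ => -(κ * t)) (κ ^ 2 * t ^ 2 * (D * t)) := by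
    refine SecondMomentLE.of_tendstoInMeasure h4 ?_ measurable_const tendsto_const_nhds ?_
    · intro N
      have hm := measurable_entry hF
      fun_prop
    · filter_upwards [eventually_ne_atTop 0] with N hN
      have hN' : (N : ℝ) ≠ 0 := by exact_mod_cast hN
      have hg1 : ∀ k < N, grid (t / (N : ℝ≥0)) k ≤ t := fun k hk => by
        have h6 : grid (t / (N : ℝ≥0)) k ≤ grid t 1 := by
          rw [← grid_div_mul t hN 1]; exact grid_mono _ (by omega)
        simpa [grid] using h6
      have h6 := (SecondMomentLE.sum (μ := μ) (a := D * t)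
        (f := fun k ω => F (grid (t / (N : ℝ≥0)) k) ω 0 0 - 1) N (fun k hk => by
          have h7 := secondMoment_incr hF hq (T := 1) (t / (N : ℝ≥0)) 0 k (by
            rw [zero_add]; exact_mod_cast (hg1 k hk).trans ht1) 0 0
          have hg0 : grid (t / (N : ℝ≥0)) 0 = 0 := by simp [grid]
          rw [zero_add, hg0] at h7
          refine (h7.mono ?_).congr ?_
          · refine mul_le_mul_of_nonneg_left ?_ hD0
            have := hg1 k hk
            unfold grid at this
            exact_mod_cast this
          · filter_upwards [hF.initial] with ω hω
            rw [hω]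
            simp)).const_mul (κ * (t / N))
      refine h6.mono (le_of_eq ?_)
      field_simp
  have h6 := h5.2
  simp only [integral_const, smul_eq_mul] at h6
  simp only [probReal_univ, one_mul] at h6
  by_contra hne
  have h7 : 0 < κ ^ 2 * (t : ℝ) ^ 2 := by positivity
  nlinarith

/-- The three properties of `F` determine the covariance form of `B`. -/
theorem covariance_eq (G : Matrix (Fin 2) (Fin 2) ℝ) :
    (q G : ℝ) = 1 / 4 * (G 0 0 - G 1 1) ^ 2 + 3 / 4 * G 1 0 ^ 2 + 3 / 4 * G 0 1 ^ 2
      - 1 / 2 * (G 1 0 * G 0 1) := by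
  obtain ⟨A₁, A₂, A₃, A₁₂, A₁₃, A₂₃, hA⟩ := HasCovarianceForm.exists_coeff hF.driver hq
  have r0 := covariance_row hF hq 0
  have r1 := covariance_row hF hq 1
  have hκ := meanSquare_eq_zero hF hq
  have hrefl : (!![1, 0; 0, -1] : Matrix (Fin 2) (Fin 2) ℝ) ∈ Matrix.orthogonalGroup (Fin 2) ℝ := by
    rw [Matrix.mem_orthogonalGroup_iff]
    ext i j; fin_cases i <;> fin_cases j <;> simp [Matrix.mul_apply, Fin.sum_univ_two]
  -- The rotation by an angle with rational sine and cosine, not a multiple of `π / 4`.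
  have hrot : (!![3/5, 4/5; -4/5, 3/5] : Matrix (Fin 2) (Fin 2) ℝ)
      ∈ Matrix.orthogonalGroup (Fin 2) ℝ := by
    rw [Matrix.mem_orthogonalGroup_iff]
    ext i j; fin_cases i <;> fin_cases j <;> simp [Matrix.mul_apply, Fin.sum_univ_two] <;> norm_num
  have c1 := covariance_conj hF hq ⟨_, hrefl⟩ (Matrix.single 0 0 1 + Matrix.single 1 0 1)
  have c2 := covariance_conj hF hq ⟨_, hrefl⟩ (Matrix.single 0 0 1 + Matrix.single 0 1 1)
  have c3 := covariance_conj hF hq ⟨_, hrot⟩ (Matrix.single 0 0 1)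
  have hinv : ∀ O : Matrix.orthogonalGroup (Fin 2) ℝ,
      ((O⁻¹ : Matrix.orthogonalGroup (Fin 2) ℝ) : Matrix (Fin 2) (Fin 2) ℝ)
        = (O : Matrix (Fin 2) (Fin 2) ℝ)ᵀ := fun O => rfl
  rw [hinv] at c1 c2 c3
  rw [meanSquare] at hκ
  rw [hA] at r0 r1 c1 c2 c3 hκ
  rw [hA] at r0 r1 c1 c2 c3 hκ
  rw [hA, hA] at hκ
  simp [Matrix.mul_apply, Fin.sum_univ_two, Matrix.single] at r0 r1 c1 c2 c3 hκ
  rw [hA]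
  have e1 : A₁₂ = 0 := by linarith
  have e2 : A₁₃ = 0 := by linarith
  have e3 : A₁ = 1 / 4 := by linarith
  have e4 : A₂ = 3 / 4 := by linarith
  have e5 : A₃ = 3 / 4 := by linarith
  have e6 : A₂₃ = - 1 / 4 := by linarith
  rw [e1, e2, e3, e4, e5, e6]
  ring

end IsGeometricBrownianMotionSL

end

/-! ### One step of the Euler scheme -/

section

variable {Ω : Type*} {mΩ : MeasurableSpace Ω} {μ : Measure Ω} {ℱ : Filtration ℝ≥0 mΩ}
  {B F : ℝ≥0 → Ω → Matrix (Fin 2) (Fin 2) ℝ} {q : Matrix (Fin 2) (Fin 2) ℝ → ℝ≥0}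

/-- The second order expansion of `(1 + z)^p` at `0`, with a remainder that is valid for all
`z ≥ -1`. -/
lemma exists_abs_one_add_rpow_sub_le {p : ℝ} (hp : 1 ≤ p) : ∃ C : ℝ, 0 ≤ C ∧ ∃ n : ℕ,
    ∀ z : ℝ, -1 ≤ z →
      |(1 + z) ^ p - (1 + p * z + p * (p - 1) / 2 * z ^ 2)| ≤ C * (|z| ^ 3 * (1 + |z|) ^ n) := by
  have hO := (Real.one_add_rpow_hasFPowerSeriesAt_zero (a := p)).isBigO_sub_partialSum_pow 3
  have hch : Ring.choose p 2 = p * (p - 1) / 2 := by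
    rw [Ring.choose_eq_smul]
    simp [descPochhammer_succ_right, Polynomial.smeval_mul, Polynomial.smeval_sub,
      Polynomial.smeval_one, Polynomial.smeval_X]
    ring
  obtain ⟨C₀, hC₀⟩ := hO.bound
  obtain ⟨ε, hε, hball⟩ := Metric.eventually_nhds_iff.1 hC₀
  have hpoly : ∀ z : ℝ, (binomialSeries ℝ p).partialSum 3 z
      = 1 + p * z + p * (p - 1) / 2 * z ^ 2 := by
    intro z
    simp [FormalMultilinearSeries.partialSum, Finset.sum_range_succ, hch, List.ofFn_const,
      -FormalMultilinearSeries.apply_eq_prod_smul_coeff]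
  set n := ⌈p⌉₊ + 2 with hn
  set D : ℝ := (2 + p + p * (p - 1) / 2) / ε ^ 3 with hD
  have hp1 : 0 ≤ p * (p - 1) / 2 := by
    have : 0 ≤ p - 1 := by linarith
    positivity
  have hD0 : 0 ≤ D := by positivity
  refine ⟨|C₀| + D, by positivity, n, fun z hz => ?_⟩
  have h1z : 1 ≤ 1 + |z| := by linarith [abs_nonneg z]
  have hpow1 : ∀ k : ℕ, 1 ≤ (1 + |z|) ^ k := fun k => one_le_pow₀ h1z
  -- Near `0` this is the binomial series; away from `0` every term is dominated.
  rcases lt_or_ge |z| ε with hlt | hge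
  · have h := hball (y := z) (by simpa using hlt)
    rw [zero_add, hpoly] at h
    rw [Real.norm_eq_abs, Real.norm_eq_abs, Real.norm_eq_abs,
      abs_of_nonneg (by positivity : 0 ≤ |z| ^ 3)] at h
    calc _ ≤ C₀ * |z| ^ 3 := h
      _ ≤ |C₀| * |z| ^ 3 := by gcongr; exact le_abs_self _
      _ ≤ (|C₀| + D) * |z| ^ 3 := by gcongr; linarith
      _ ≤ (|C₀| + D) * (|z| ^ 3 * (1 + |z|) ^ n) := by
        gcongr
        exact le_mul_of_one_le_right (by positivity) (hpow1 n)
  · have hz1 : 0 ≤ 1 + z := by linarith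
    have ha : (1 + z) ^ p ≤ (1 + |z|) ^ n := by
      calc (1 + z) ^ p ≤ (1 + |z|) ^ p :=
            Real.rpow_le_rpow hz1 (by linarith [le_abs_self z]) (by linarith)
        _ ≤ (1 + |z|) ^ (n : ℝ) := by
            refine Real.rpow_le_rpow_of_exponent_le h1z ?_
            rw [hn]; push_cast
            linarith [Nat.le_ceil p]
        _ = _ := Real.rpow_natCast _ _
    have h2 : (1 + |z|) ^ 2 ≤ (1 + |z|) ^ n := pow_le_pow_right₀ h1z (by omega)
    have hb : |z| ≤ (1 + |z|) ^ n := by nlinarith [abs_nonneg z]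
    have hc : z ^ 2 ≤ (1 + |z|) ^ n := by
      rw [← sq_abs]; nlinarith [abs_nonneg z]
    have hm : |(1 + z) ^ p - (1 + p * z + p * (p - 1) / 2 * z ^ 2)|
        ≤ (2 + p + p * (p - 1) / 2) * (1 + |z|) ^ n := by
      have h0 := Real.rpow_nonneg hz1 p
      have hb' : |p * z| ≤ p * (1 + |z|) ^ n := by
        rw [abs_mul, abs_of_pos (by linarith : 0 < p)]; gcongr
      have hc' : p * (p - 1) / 2 * z ^ 2 ≤ p * (p - 1) / 2 * (1 + |z|) ^ n := by gcongr
      have hc0 : 0 ≤ p * (p - 1) / 2 * z ^ 2 := by positivity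
      rw [abs_le] at hb' ⊢
      have := hpow1 n
      constructor <;> nlinarith
    have hε3 : 1 ≤ |z| ^ 3 / ε ^ 3 := by
      rw [one_le_div (by positivity)]; gcongr
    calc _ ≤ (2 + p + p * (p - 1) / 2) * (1 + |z|) ^ n := hm
      _ ≤ (2 + p + p * (p - 1) / 2) * (1 + |z|) ^ n * (|z| ^ 3 / ε ^ 3) :=
        le_mul_of_one_le_right (by positivity) hε3
      _ = D * (|z| ^ 3 * (1 + |z|) ^ n) := by rw [hD]; ring
      _ ≤ _ := by gcongr; linarith [abs_nonneg C₀]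

/-- The expansion of `(1 + z)^p` to third order in `w`, for `z = 2 l + v` with `l = O(w)` and
`v = O(w²)`. -/
lemma exists_abs_rpow_sub_le {p : ℝ} (hp : 1 ≤ p) : ∃ C : ℝ, 0 ≤ C ∧ ∃ n : ℕ,
    ∀ w l v : ℝ, |l| ≤ w → 0 ≤ v → v ≤ w ^ 2 → -1 ≤ 2 * l + v →
      |(1 + (2 * l + v)) ^ p - (1 + p * (2 * l + v) + 2 * p * (p - 1) * l ^ 2)| ≤
        C * (w ^ 3 * (1 + w) ^ n) := by
  obtain ⟨C, hC, n, h⟩ := exists_abs_one_add_rpow_sub_le hp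
  have hp1 : 0 ≤ p * (p - 1) / 2 := by
    have : 0 ≤ p - 1 := by linarith
    positivity
  refine ⟨8 * C + 4 * (p * (p - 1) / 2), by positivity, 3 + 2 * n, fun w l v hl hv hvw hz => ?_⟩
  have hw : 0 ≤ w := (abs_nonneg l).trans hl
  have h1 := h _ hz
  set z := 2 * l + v with hzdef
  have hz2 : |z| ≤ 2 * w + w ^ 2 := by
    rw [abs_le] at hl ⊢
    constructor <;> nlinarith [hl.1, hl.2]
  have hA : |z| ^ 3 * (1 + |z|) ^ n ≤ 8 * (w ^ 3 * (1 + w) ^ (3 + 2 * n)) := by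
    have e1 : |z| ≤ 2 * w * (1 + w) := by nlinarith
    have e2 : 1 + |z| ≤ (1 + w) ^ 2 := by nlinarith
    calc |z| ^ 3 * (1 + |z|) ^ n ≤ (2 * w * (1 + w)) ^ 3 * ((1 + w) ^ 2) ^ n := by gcongr
      _ = _ := by rw [pow_add, pow_mul]; ring
  have hB : |z ^ 2 - 4 * l ^ 2| ≤ 4 * (w ^ 3 * (1 + w) ^ (3 + 2 * n)) := by
    have e1 : z ^ 2 - 4 * l ^ 2 = 4 * (l * v) + v ^ 2 := by rw [hzdef]; ring
    have e2 : |l * v| ≤ w ^ 3 := by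
      rw [abs_mul, abs_of_nonneg hv]
      calc |l| * v ≤ w * w ^ 2 := by gcongr
        _ = w ^ 3 := by ring
    have e3 : v ^ 2 ≤ w ^ 3 * w := by
      calc v ^ 2 ≤ (w ^ 2) ^ 2 := by gcongr
        _ = _ := by ring
    have e4 : (1 + w) ≤ (1 + w) ^ (3 + 2 * n) := le_self_pow₀ (by linarith) (by omega)
    have e5 : w ^ 3 * (1 + w) ≤ w ^ 3 * (1 + w) ^ (3 + 2 * n) := by gcongr
    have e6 : 0 ≤ w ^ 3 * w := by positivity
    rw [e1, abs_le]
    rw [abs_le] at e2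
    constructor <;> nlinarith [sq_nonneg v]
  have e : (1 + z) ^ p - (1 + p * z + 2 * p * (p - 1) * l ^ 2)
      = ((1 + z) ^ p - (1 + p * z + p * (p - 1) / 2 * z ^ 2))
        + p * (p - 1) / 2 * (z ^ 2 - 4 * l ^ 2) := by ring
  rw [e]
  refine (abs_add_le _ _).trans ?_
  rw [abs_mul, abs_of_nonneg hp1]
  calc _ ≤ C * (8 * (w ^ 3 * (1 + w) ^ (3 + 2 * n)))
        + p * (p - 1) / 2 * (4 * (w ^ 3 * (1 + w) ^ (3 + 2 * n))) := by
        gcongr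
        exact h1.trans (by gcongr)
    _ = _ := by ring

lemma sum_four_pow_le (n : ℕ) {a b c d : ℝ} (ha : 0 ≤ a) (hb : 0 ≤ b) (hc : 0 ≤ c) (hd : 0 ≤ d) :
    (a + b + c + d) ^ 3 * (1 + (a + b + c + d)) ^ n ≤
      64 * (a ^ 3 * (1 + 4 * a) ^ n + b ^ 3 * (1 + 4 * b) ^ n + c ^ 3 * (1 + 4 * c) ^ n
        + d ^ 3 * (1 + 4 * d) ^ n) := by
  have key : ∀ m : ℝ, a ≤ m → b ≤ m → c ≤ m → d ≤ m → (a + b + c + d) ^ 3 *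
      (1 + (a + b + c + d)) ^ n ≤ 64 * (m ^ 3 * (1 + 4 * m) ^ n) := by
    intro m h1 h2 h3 h4
    have h5 : a + b + c + d ≤ 4 * m := by linarith
    have hm : 0 ≤ m := ha.trans h1
    calc _ ≤ (4 * m) ^ 3 * (1 + 4 * m) ^ n := by gcongr
      _ = _ := by ring
  have pa : 0 ≤ a ^ 3 * (1 + 4 * a) ^ n := by positivity
  have pb : 0 ≤ b ^ 3 * (1 + 4 * b) ^ n := by positivity
  have pc : 0 ≤ c ^ 3 * (1 + 4 * c) ^ n := by positivity
  have pd : 0 ≤ d ^ 3 * (1 + 4 * d) ^ n := by positivity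
  rcases le_total a b with h1 | h1 <;> rcases le_total c d with h2 | h2
  · rcases le_total b d with h3 | h3
    · linarith [key d (by linarith) h3 h2 le_rfl]
    · linarith [key b h1 le_rfl (by linarith) h3]
  · rcases le_total b c with h3 | h3
    · linarith [key c (by linarith) h3 le_rfl h2]
    · linarith [key b h1 le_rfl h3 (by linarith)]
  · rcases le_total a d with h3 | h3
    · linarith [key d h3 (by linarith) h2 le_rfl]
    · linarith [key a le_rfl h1 (by linarith) h3]
  · rcases le_total a c with h3 | h3
    · linarith [key c h3 (by linarith) le_rfl h2]
    · linarith [key a le_rfl h1 h3 (by linarith)]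

/-- `|u (1 + b)|²` for the row vector `u = (x, y)`. -/
def stepNormSq (x y : ℝ) (b : Fin 2 → Fin 2 → ℝ) : ℝ :=
  (x + (x * b 0 0 + y * b 1 0)) ^ 2 + (y + (x * b 0 1 + y * b 1 1)) ^ 2

lemma stepNormSq_nonneg (x y : ℝ) (b : Fin 2 → Fin 2 → ℝ) : 0 ≤ stepNormSq x y b := by
  unfold stepNormSq; positivity

/-- The covariance form that is invariant under conjugation by `O(2)` and for which `𝔼 B₁² = 0`
and `𝔼 B₁ B₁* = 1`. -/
def IsIsotropic (q : Matrix (Fin 2) (Fin 2) ℝ → ℝ≥0) : Prop :=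
  ∀ G : Matrix (Fin 2) (Fin 2) ℝ, (q G : ℝ) =
    1 / 4 * (G 0 0 - G 1 1) ^ 2 + 3 / 4 * G 1 0 ^ 2 + 3 / 4 * G 0 1 ^ 2 - 1 / 2 * (G 1 0 * G 0 1)

/-- The growth of the `2p`-th moment of the length of a fixed vector in one step of the Euler
scheme. For a unit vector `u`, `|u (1 + b)|² = 1 + 2 l + v` with `l = u b u*` and `v = |u b|²`, and
`𝔼 l² = h / 4`, `𝔼 v = h` for a step of length `h`, whatever the direction of `u`. -/
theorem exists_abs_integral_stepNormSq_sub_le [IsProbabilityMeasure μ]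
    (hB : IsBrownianMotionSL μ ℱ B) (hq : HasCovarianceForm μ B q) (hiso : IsIsotropic q)
    {p : ℝ} (hp : 1 ≤ p) : ∃ C : ℝ, 0 ≤ C ∧ ∀ s t : ℝ≥0, s ≤ t → t - s ≤ 1 → ∀ x y : ℝ,
      Integrable (fun ω => stepNormSq x y (fun i j => B t ω i j - B s ω i j) ^ p) μ ∧
      |∫ ω, stepNormSq x y (fun i j => B t ω i j - B s ω i j) ^ p ∂μ
        - (1 + p * (p + 1) / 2 * ((t : ℝ) - s)) * (x ^ 2 + y ^ 2) ^ p|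
        ≤ C * √((t - s : ℝ≥0) : ℝ) ^ 3 * (x ^ 2 + y ^ 2) ^ p := by
  obtain ⟨C, hC, n, hT⟩ := exists_abs_rpow_sub_le hp
  choose M hM0 hM using fun i j : Fin 2 =>
    gaussian_moment_le μ (q (Matrix.single j i 1)) 3 n 4
  refine ⟨C * 64 * (M 0 0 + M 0 1 + M 1 0 + M 1 1), by
    have := hM0 0 0; have := hM0 0 1; have := hM0 1 0; have := hM0 1 1; positivity, ?_⟩
  intro s t hst h1 x y
  have hp0 : p ≠ 0 := by linarith
  set h : ℝ := (t : ℝ) - s with hh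
  have hmB : ∀ i j, Measurable (fun ω => (B t ω - B s ω) i j) := fun i j =>
    (IsBrownianMotionSL.measurable_incr_filtration hB hst i j).mono (ℱ.le t) le_rfl
  rcases (add_nonneg (sq_nonneg x) (sq_nonneg y)).eq_or_lt with h0 | hpos
  · have hx : x = 0 := by nlinarith [sq_nonneg x, sq_nonneg y]
    have hy : y = 0 := by nlinarith [sq_nonneg x, sq_nonneg y]
    subst hx hy
    simp [stepNormSq, Real.zero_rpow hp0]
  set r := x ^ 2 + y ^ 2 with hr
  set l : Ω → ℝ := fun ω => ((B t ω - B s ω) * !![x ^ 2, x * y; x * y, y ^ 2]).trace / r with hl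
  set v : Ω → ℝ := fun ω => (((B t ω - B s ω) * !![x, y; 0, 0]).trace ^ 2 +
    ((B t ω - B s ω) * !![0, 0; x, y]).trace ^ 2) / r with hv
  set w : Ω → ℝ := fun ω => |(B t ω - B s ω) 0 0| + |(B t ω - B s ω) 0 1|
    + |(B t ω - B s ω) 1 0| + |(B t ω - B s ω) 1 1| with hw
  have hl_apply : ∀ ω, l ω = (x ^ 2 * (B t ω - B s ω) 0 0 + x * y * (B t ω - B s ω) 0 1 +
      (x * y * (B t ω - B s ω) 1 0 + y ^ 2 * (B t ω - B s ω) 1 1)) / r := fun ω => by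
    simp [hl, trace_mul_eq]
  have hv_apply : ∀ ω, v ω = ((x * (B t ω - B s ω) 0 0 + y * (B t ω - B s ω) 1 0) ^ 2 +
      (x * (B t ω - B s ω) 0 1 + y * (B t ω - B s ω) 1 1) ^ 2) / r := fun ω => by
    simp [hv, trace_mul_eq]
  have hstep : ∀ ω, stepNormSq x y (fun i j => B t ω i j - B s ω i j)
      = r * (1 + (2 * l ω + v ω)) := by
    intro ω
    rw [hl_apply, hv_apply]
    simp only [stepNormSq, Matrix.sub_apply]
    field_simp
    rw [hr]
    ring
  have hlw : ∀ ω, |l ω| ≤ w ω := by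
    intro ω
    rw [hl_apply, abs_div, abs_of_pos hpos, div_le_iff₀ hpos]
    have hx2 : |x ^ 2| ≤ r := by rw [abs_of_nonneg (sq_nonneg x), hr]; nlinarith [sq_nonneg y]
    have hy2 : |y ^ 2| ≤ r := by rw [abs_of_nonneg (sq_nonneg y), hr]; nlinarith [sq_nonneg x]
    have hxy : |x * y| ≤ r := by
      rw [abs_le, hr]
      constructor <;> nlinarith [sq_nonneg (x - y), sq_nonneg (x + y)]
    have hone : ∀ k z : ℝ, |k| ≤ r → |k * z| ≤ |z| * r := fun k z hk => by
      rw [abs_mul, mul_comm]; gcongr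
    refine ((abs_add_le _ _).trans (add_le_add (abs_add_le _ _) (abs_add_le _ _))).trans ?_
    have g1 := hone _ ((B t ω - B s ω) 0 0) hx2
    have g2 := hone _ ((B t ω - B s ω) 0 1) hxy
    have g3 := hone _ ((B t ω - B s ω) 1 0) hxy
    have g4 := hone _ ((B t ω - B s ω) 1 1) hy2
    simp only [hw]
    linarith
  have hv0 : ∀ ω, 0 ≤ v ω := fun ω => by simp only [hv]; positivity
  have hvw : ∀ ω, v ω ≤ w ω ^ 2 := by
    intro ω
    rw [hv_apply, div_le_iff₀ hpos]
    have hcs : ∀ a b : ℝ, (x * a + y * b) ^ 2 ≤ (|a| ^ 2 + |b| ^ 2) * r := fun a b => by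
      rw [sq_abs, sq_abs, hr]; nlinarith [sq_nonneg (x * b - y * a)]
    have g1 := hcs ((B t ω - B s ω) 0 0) ((B t ω - B s ω) 1 0)
    have g2 := hcs ((B t ω - B s ω) 0 1) ((B t ω - B s ω) 1 1)
    have g3 : |(B t ω - B s ω) 0 0| ^ 2 + |(B t ω - B s ω) 1 0| ^ 2
        + (|(B t ω - B s ω) 0 1| ^ 2 + |(B t ω - B s ω) 1 1| ^ 2) ≤ w ω ^ 2 := by
      have a1 := abs_nonneg ((B t ω - B s ω) 0 0)
      have a2 := abs_nonneg ((B t ω - B s ω) 0 1)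
      have a3 := abs_nonneg ((B t ω - B s ω) 1 0)
      have a4 := abs_nonneg ((B t ω - B s ω) 1 1)
      have e1 := mul_nonneg a1 a2
      have e2 := mul_nonneg a1 a3
      have e3 := mul_nonneg a1 a4
      have e4 := mul_nonneg a2 a3
      have e5 := mul_nonneg a2 a4
      have e6 := mul_nonneg a3 a4
      simp only [hw]
      linarith
    calc _ ≤ (|(B t ω - B s ω) 0 0| ^ 2 + |(B t ω - B s ω) 1 0| ^ 2) * r
          + (|(B t ω - B s ω) 0 1| ^ 2 + |(B t ω - B s ω) 1 1| ^ 2) * r := add_le_add g1 g2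
      _ = _ * r := by rw [← add_mul]
      _ ≤ _ := by gcongr
  have hz : ∀ ω, -1 ≤ 2 * l ω + v ω := by
    intro ω
    have g1 := stepNormSq_nonneg x y (fun i j => B t ω i j - B s ω i j)
    rw [hstep] at g1
    have g2 := nonneg_of_mul_nonneg_right g1 hpos
    linarith
  -- The main terms of the expansion.
  set m : Ω → ℝ := fun ω => 1 + p * (2 * l ω + v ω) + 2 * p * (p - 1) * l ω ^ 2 with hm
  have hlL : MemLp l 2 μ := by
    simp only [hl, div_eq_mul_inv]
    exact (hq.memLp_two hst _).mul_const (r⁻¹)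
  have hl_int : Integrable l μ := hlL.integrable (by norm_num)
  have hT1 : MemLp (fun ω => ((B t ω - B s ω) * !![x, y; 0, 0]).trace) 2 μ :=
    hq.memLp_two hst _
  have hT2 : MemLp (fun ω => ((B t ω - B s ω) * !![0, 0; x, y]).trace) 2 μ :=
    hq.memLp_two hst _
  have hv_int : Integrable v μ := (hT1.integrable_sq.add hT2.integrable_sq).div_const r
  have hl_mean : ∫ ω, l ω ∂μ = 0 := by
    simp only [hl, integral_div, hq.integral_eq_zero hst, zero_div]
  have hl_sq : ∫ ω, l ω ^ 2 ∂μ = h / 4 := by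
    simp only [hl, div_pow, integral_div, hq.integral_sq hst]
    rw [hiso]
    simp
    rw [← hh]
    field_simp
    rw [hr]
    ring
  have hv_mean : ∫ ω, v ω ∂μ = h := by
    simp only [hv, integral_div]
    rw [integral_add hT1.integrable_sq hT2.integrable_sq, hq.integral_sq hst, hq.integral_sq hst,
      hiso, hiso]
    simp
    rw [← hh]
    field_simp
    rw [hr]
    ring
  have hlv_int : Integrable (fun ω => 2 * l ω + v ω) μ := (hl_int.const_mul 2).add hv_int
  have hm1_int : Integrable (fun ω => 1 + p * (2 * l ω + v ω)) μ :=
    (integrable_const 1).add (hlv_int.const_mul p)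
  have hm2_int : Integrable (fun ω => 2 * p * (p - 1) * l ω ^ 2) μ :=
    hlL.integrable_sq.const_mul _
  have hm_int : Integrable m μ := hm1_int.add hm2_int
  have hm_mean : ∫ ω, m ω ∂μ = 1 + p * (p + 1) / 2 * h := by
    simp only [hm]
    rw [integral_add hm1_int hm2_int, integral_add (integrable_const 1) (hlv_int.const_mul p),
      integral_const_mul, integral_const_mul, integral_add (hl_int.const_mul 2) hv_int,
      integral_const_mul, hl_mean, hl_sq, hv_mean]
    simp
    ring
  -- The remainder.
  have hM' : ∀ i j, Integrable (fun ω => |(B t ω - B s ω) i j| ^ 3 *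
      (1 + 4 * |(B t ω - B s ω) i j|) ^ n) μ ∧ ∫ ω, |(B t ω - B s ω) i j| ^ 3 *
      (1 + 4 * |(B t ω - B s ω) i j|) ^ n ∂μ ≤ M i j * √((t - s : ℝ≥0) : ℝ) ^ 3 := fun i j => by
    simpa using hM i j (t - s) h1 _ (hq.hasLaw_entry hst i j)
  set ρ : Ω → ℝ := fun ω => C * (64 *
    (|(B t ω - B s ω) 0 0| ^ 3 * (1 + 4 * |(B t ω - B s ω) 0 0|) ^ n
    + |(B t ω - B s ω) 0 1| ^ 3 * (1 + 4 * |(B t ω - B s ω) 0 1|) ^ n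
    + |(B t ω - B s ω) 1 0| ^ 3 * (1 + 4 * |(B t ω - B s ω) 1 0|) ^ n
    + |(B t ω - B s ω) 1 1| ^ 3 * (1 + 4 * |(B t ω - B s ω) 1 1|) ^ n)) with hρ
  have i2 := (hM' 0 0).1.add (hM' 0 1).1
  have i3 := i2.add (hM' 1 0).1
  have i4 := i3.add (hM' 1 1).1
  have hρ_int : Integrable ρ μ := (i4.const_mul 64).const_mul C
  have hρ_mean : ∫ ω, ρ ω ∂μ ≤
      C * 64 * (M 0 0 + M 0 1 + M 1 0 + M 1 1) * √((t - s : ℝ≥0) : ℝ) ^ 3 := by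
    simp only [hρ, integral_const_mul]
    have e4 := integral_add i3 (hM' 1 1).1
    have e3 := integral_add i2 (hM' 1 0).1
    have e2 := integral_add (hM' 0 0).1 (hM' 0 1).1
    simp only [Pi.add_apply] at e2 e3 e4
    rw [e4, e3, e2, mul_assoc C, mul_assoc C, mul_assoc 64]
    gcongr
    linarith [(hM' 0 0).2, (hM' 0 1).2, (hM' 1 0).2, (hM' 1 1).2]
  set T : Ω → ℝ := fun ω => (1 + (2 * l ω + v ω)) ^ p with hTdef
  have hbd : ∀ ω, |T ω - m ω| ≤ ρ ω := by
    intro ω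
    refine (hT (w ω) (l ω) (v ω) (hlw ω) (hv0 ω) (hvw ω) (hz ω)).trans ?_
    simp only [hρ, hw]
    refine mul_le_mul_of_nonneg_left ?_ hC
    exact sum_four_pow_le n (abs_nonneg _) (abs_nonneg _) (abs_nonneg _) (abs_nonneg _)
  have hTm : AEStronglyMeasurable T μ := by
    have : Measurable (fun z : ℝ => z ^ p) := by fun_prop
    exact (this.comp_aemeasurable
      ((hlv_int.1.aemeasurable.const_add 1))).aestronglyMeasurable
  have hd_int : Integrable (fun ω => T ω - m ω) μ :=
    hρ_int.mono' (hTm.sub hm_int.1) (ae_of_all _ fun ω => by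
      rw [Real.norm_eq_abs]; exact hbd ω)
  have hT_int : Integrable T μ := (hd_int.add hm_int).congr (ae_of_all _ fun ω => by simp)
  have hpw : ∀ ω, stepNormSq x y (fun i j => B t ω i j - B s ω i j) ^ p = r ^ p * T ω := by
    intro ω
    rw [hstep, Real.mul_rpow hpos.le (by linarith [hz ω])]
  simp only [hpw]
  refine ⟨hT_int.const_mul _, ?_⟩
  rw [integral_const_mul, mul_comm _ (r ^ p), ← mul_sub, ← hm_mean,
    ← integral_sub hT_int hm_int, abs_mul, abs_of_nonneg (Real.rpow_nonneg hpos.le p),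
    mul_comm (r ^ p)]
  refine mul_le_mul_of_nonneg_right ?_ (Real.rpow_nonneg hpos.le p)
  exact (abs_integral_le_integral_abs.trans (integral_mono hd_int.abs hρ_int hbd)).trans hρ_mean

/-- The growth of the `2p`-th moment of the length of a random vector in one step of the Euler
scheme: the vector is independent of the increment, so it may be held fixed. -/
theorem exists_lintegral_stepNormSq_le [IsProbabilityMeasure μ]
    (hB : IsBrownianMotionSL μ ℱ B) (hq : HasCovarianceForm μ B q) (hiso : IsIsotropic q)
    {p : ℝ} (hp : 1 ≤ p) : ∃ C : ℝ, 0 ≤ C ∧ ∀ s t : ℝ≥0, s ≤ t → t - s ≤ 1 → ∀ U V : Ω → ℝ,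
      Measurable[ℱ s] U → Measurable[ℱ s] V →
      ∫⁻ ω, ENNReal.ofReal (stepNormSq (U ω) (V ω) (fun i j => B t ω i j - B s ω i j) ^ p) ∂μ ≤
        ENNReal.ofReal (1 + p * (p + 1) / 2 * ((t : ℝ) - s) + C * √((t - s : ℝ≥0) : ℝ) ^ 3) *
          ∫⁻ ω, ENNReal.ofReal ((U ω ^ 2 + V ω ^ 2) ^ p) ∂μ ∧
      ENNReal.ofReal (1 + p * (p + 1) / 2 * ((t : ℝ) - s) - C * √((t - s : ℝ≥0) : ℝ) ^ 3) *
          ∫⁻ ω, ENNReal.ofReal ((U ω ^ 2 + V ω ^ 2) ^ p) ∂μ ≤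
      ∫⁻ ω, ENNReal.ofReal (stepNormSq (U ω) (V ω) (fun i j => B t ω i j - B s ω i j) ^ p) ∂μ := by
  obtain ⟨C, hC, h⟩ := exists_abs_integral_stepNormSq_sub_le hB hq hiso hp
  refine ⟨C, hC, fun s t hst h1 U V hU hV => ?_⟩
  have hUm : Measurable U := hU.mono (ℱ.le s) le_rfl
  have hVm : Measurable V := hV.mono (ℱ.le s) le_rfl
  set D : Ω → Fin 2 → Fin 2 → ℝ := fun ω i j => B t ω i j - B s ω i j with hD
  have hDm : Measurable D := measurable_pi_iff.2 fun i => measurable_pi_iff.2 fun j =>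
    (IsBrownianMotionSL.measurable_incr_filtration hB hst i j).mono (ℱ.le t) le_rfl
  have hind : (fun ω => (U ω, V ω)) ⟂ᵢ[μ] D := indepFun_of_indep (hU.prodMk hV) (hB.indep s t hst)
  set φ : (ℝ × ℝ) × (Fin 2 → Fin 2 → ℝ) → ℝ≥0∞ := fun z =>
    ENNReal.ofReal (stepNormSq z.1.1 z.1.2 z.2 ^ p) with hφ
  have hφm : Measurable φ := by
    simp only [hφ, stepNormSq]
    fun_prop
  have hUV : Measurable (fun ω => (U ω, V ω)) := hUm.prodMk hVm
  have hprod := (indepFun_iff_map_prod_eq_prod_map_map hUV.aemeasurable hDm.aemeasurable).1 hind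
  have hfub : ∫⁻ ω, ENNReal.ofReal (stepNormSq (U ω) (V ω) (D ω) ^ p) ∂μ
      = ∫⁻ ω, ENNReal.ofReal (∫ ω', stepNormSq (U ω) (V ω) (D ω') ^ p ∂μ) ∂μ := by
    have e1 : ∫⁻ ω, ENNReal.ofReal (stepNormSq (U ω) (V ω) (D ω) ^ p) ∂μ
        = ∫⁻ z, φ z ∂(μ.map (fun ω => ((U ω, V ω), D ω))) :=
      (lintegral_map hφm (hUV.prodMk hDm)).symm
    rw [e1, hprod, lintegral_prod _ hφm.aemeasurable,
      lintegral_map (hφm.lintegral_prod_right') hUV]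
    refine lintegral_congr fun ω => ?_
    rw [lintegral_map (f := fun y => φ ((U ω, V ω), y)) (hφm.comp measurable_prodMk_left) hDm,
      ofReal_integral_eq_lintegral_ofReal (h s t hst h1 _ _).1
      (ae_of_all _ fun ω' => Real.rpow_nonneg (stepNormSq_nonneg _ _ _) _)]
  rw [hfub]
  have hm : Measurable (fun ω => ENNReal.ofReal ((U ω ^ 2 + V ω ^ 2) ^ p)) := by fun_prop
  have hr0 : ∀ ω, 0 ≤ (U ω ^ 2 + V ω ^ 2) ^ p := fun ω => by positivity
  constructor
  · rw [← lintegral_const_mul _ hm]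
    refine lintegral_mono fun ω => ?_
    rw [← ENNReal.ofReal_mul' (hr0 ω)]
    apply ENNReal.ofReal_le_ofReal
    have := (abs_le.1 (h s t hst h1 (U ω) (V ω)).2).2
    linarith
  · rw [← lintegral_const_mul _ hm]
    refine lintegral_mono fun ω => ?_
    rw [← ENNReal.ofReal_mul' (hr0 ω)]
    apply ENNReal.ofReal_le_ofReal
    have := (abs_le.1 (h s t hst h1 (U ω) (V ω)).2).1
    linarith

end

/-! ### Convergence and moments of the Euler scheme -/

section

variable {Ω : Type*} {mΩ : MeasurableSpace Ω} {μ : Measure Ω} {ℱ : Filtration ℝ≥0 mΩ}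
  {B F : ℝ≥0 → Ω → Matrix (Fin 2) (Fin 2) ℝ} {q : Matrix (Fin 2) (Fin 2) ℝ → ℝ≥0}

/-- The Euler scheme for `dF = F dB`, `F₀ = 1`, along the times `π 0 ≤ π 1 ≤ …`. -/
noncomputable def euler (B : ℝ≥0 → Ω → Matrix (Fin 2) (Fin 2) ℝ) (π : ℕ → ℝ≥0) :
    ℕ → Ω → Matrix (Fin 2) (Fin 2) ℝ
  | 0, _ => 1
  | k + 1, ω => euler B π k ω + euler B π k ω * (B (π (k + 1)) ω - B (π k) ω)

lemma euler_eq_sum (π : ℕ → ℝ≥0) (n : ℕ) (ω : Ω) : euler B π n ω =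
    1 + ∑ k ∈ Finset.range n, euler B π k ω * (B (π (k + 1)) ω - B (π k) ω) := by
  induction n with
  | zero => simp [euler]
  | succ n ih =>
    rw [Finset.sum_range_succ, ← add_assoc, ← ih, euler]

lemma euler_succ_entry (π : ℕ → ℝ≥0) (k : ℕ) (i j : Fin 2) (ω : Ω) : euler B π (k + 1) ω i j =
    euler B π k ω i j + (euler B π k ω i 0 * (B (π (k + 1)) ω - B (π k) ω) 0 j +
      euler B π k ω i 1 * (B (π (k + 1)) ω - B (π k) ω) 1 j) := by
  simp [euler, Matrix.mul_apply, Fin.sum_univ_two]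

lemma measurable_euler (hB : IsBrownianMotionSL μ ℱ B) {π : ℕ → ℝ≥0} (hπ : Monotone π) (k : ℕ) :
    ∀ i j, Measurable[ℱ (π k)] (fun ω => euler B π k ω i j) := by
  induction k with
  | zero => intro i j; simp only [euler]; exact measurable_const
  | succ k ih =>
    intro i j
    have hs := hπ k.le_succ
    have h1 : ∀ i j, Measurable[ℱ (π (k + 1))] (fun ω => euler B π k ω i j) := fun i j =>
      (ih i j).mono (ℱ.mono hs) le_rfl
    have h2 := IsBrownianMotionSL.measurable_incr_filtration hB hs
    simp only [euler_succ_entry]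
    exact (h1 i j).add (((h1 i 0).mul (h2 0 j)).add ((h1 i 1).mul (h2 1 j)))

lemma memLp_euler [IsProbabilityMeasure μ] (hB : IsBrownianMotionSL μ ℱ B)
    (hq : HasCovarianceForm μ B q) {π : ℕ → ℝ≥0} (hπ : Monotone π) (k : ℕ) :
    ∀ i j, MemLp (fun ω => euler B π k ω i j) 2 μ := by
  induction k with
  | zero => intro i j; simp only [euler]; exact memLp_const _
  | succ k ih =>
    intro i j
    have hs := hπ k.le_succ
    have h1 : ∀ l, MemLp (fun ω => euler B π k ω i l * (B (π (k + 1)) ω - B (π k) ω) l j) 2 μ :=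
      fun l => IndepFun.memLp_two_mul (indepFun_of_indep (measurable_euler hB hπ k i l)
        (IsBrownianMotionSL.indep_entry hB hs l j)) (ih i l) (hq.memLp_two_entry hs l j)
    simp only [euler_succ_entry]
    exact (ih i j).add ((h1 0).add (h1 1))

/-- The moments of the rows of the Euler scheme grow geometrically. -/
lemma exists_lintegral_euler_row [IsProbabilityMeasure μ] (hB : IsBrownianMotionSL μ ℱ B)
    (hq : HasCovarianceForm μ B q) (hiso : IsIsotropic q) {p : ℝ} (hp : 1 ≤ p) :
    ∃ C : ℝ, 0 ≤ C ∧ ∀ δ : ℝ≥0, δ ≤ 1 → ∀ (i : Fin 2) (n : ℕ),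
      ∫⁻ ω, ENNReal.ofReal ((euler B (grid δ) n ω i 0 ^ 2 + euler B (grid δ) n ω i 1 ^ 2) ^ p) ∂μ
        ≤ ENNReal.ofReal (1 + p * (p + 1) / 2 * δ + C * √(δ : ℝ) ^ 3) ^ n ∧
      ENNReal.ofReal (1 + p * (p + 1) / 2 * δ - C * √(δ : ℝ) ^ 3) ^ n ≤
      ∫⁻ ω, ENNReal.ofReal ((euler B (grid δ) n ω i 0 ^ 2 + euler B (grid δ) n ω i 1 ^ 2) ^ p)
        ∂μ := by
  obtain ⟨C, hC, h⟩ := exists_lintegral_stepNormSq_le hB hq hiso hp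
  refine ⟨C, hC, fun δ hδ i n => ?_⟩
  induction n with
  | zero =>
    have e : ∀ i, (1 : Matrix (Fin 2) (Fin 2) ℝ) i 0 ^ 2 + (1 : Matrix (Fin 2) (Fin 2) ℝ) i 1 ^ 2
        = 1 := Fin.forall_fin_two.2 ⟨by simp, by simp⟩
    simp [euler, e i]
  | succ n ih =>
    have h1 := h (grid δ n) (grid δ (n + 1)) (grid_mono δ n.le_succ)
      (by rw [grid_succ_tsub]; exact hδ) _ _ (measurable_euler hB (grid_mono δ) n i 0)
      (measurable_euler hB (grid_mono δ) n i 1)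
    have e : ∀ ω, stepNormSq (euler B (grid δ) n ω i 0) (euler B (grid δ) n ω i 1)
        (fun i j => B (grid δ (n + 1)) ω i j - B (grid δ n) ω i j)
        = euler B (grid δ) (n + 1) ω i 0 ^ 2 + euler B (grid δ) (n + 1) ω i 1 ^ 2 := fun ω => by
      rw [euler_succ_entry, euler_succ_entry]
      simp only [stepNormSq, Matrix.sub_apply]
    simp only [e, grid_succ_sub, grid_succ_tsub] at h1
    constructor
    · rw [pow_succ' _ n]
      exact h1.1.trans (mul_le_mul_right ih.1 _)
    · rw [pow_succ' _ n]
      exact (mul_le_mul_right ih.2 _).trans h1.2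

/-- `(1 + l h + O(h^{3/2}))^m → exp (l t)` for `h = t / m`. -/
lemma tendsto_growth (l C : ℝ) (t : ℝ≥0) :
    Tendsto (fun m : ℕ => ENNReal.ofReal (1 + l * (t / (m : ℝ≥0) : ℝ≥0)
      + C * √((t / (m : ℝ≥0) : ℝ≥0) : ℝ) ^ 3) ^ m) atTop (𝓝 (ENNReal.ofReal (Real.exp (l * t)))) := by
  have hs : Tendsto (fun m : ℕ => √((t : ℝ) / m)) atTop (𝓝 0) := by
    have h1 : Tendsto (fun m : ℕ => √((t : ℝ) / m)) atTop (𝓝 (√0)) :=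
      (Real.continuous_sqrt.tendsto 0).comp (tendsto_const_div_atTop_nhds_zero_nat _)
    simpa using h1
  have h1 : Tendsto (fun m : ℕ => (m : ℝ) * (l * (t / m) + C * √((t : ℝ) / m) ^ 3)) atTop
      (𝓝 (l * t)) := by
    have h2 : Tendsto (fun m : ℕ => l * t + C * t * √((t : ℝ) / m)) atTop
        (𝓝 (l * t + C * t * 0)) := tendsto_const_nhds.add (hs.const_mul _)
    rw [mul_zero, add_zero] at h2
    refine h2.congr' ?_
    filter_upwards [eventually_ne_atTop 0] with m hm
    have hm' : (m : ℝ) ≠ 0 := by exact_mod_cast hm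
    have h3 : √((t : ℝ) / m) ^ 3 = (t / m) * √((t : ℝ) / m) := by
      rw [pow_succ, Real.sq_sqrt (by positivity)]
    rw [h3]
    field_simp
  have h2 := Real.tendsto_one_add_pow_exp_of_tendsto h1
  have h3 : ∀ᶠ m : ℕ in atTop, 0 ≤ 1 + (l * ((t : ℝ) / m) + C * √((t : ℝ) / m) ^ 3) := by
    have h4 : Tendsto (fun m : ℕ => 1 + (l * ((t : ℝ) / m) + C * √((t : ℝ) / m) ^ 3)) atTop
        (𝓝 (1 + (l * 0 + C * 0 ^ 3))) :=
      tendsto_const_nhds.add (((tendsto_const_div_atTop_nhds_zero_nat _).const_mul l).add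
        ((hs.pow 3).const_mul C))
    exact (h4.eventually (lt_mem_nhds (by norm_num : (0 : ℝ) < _))).mono fun _ => le_of_lt
  refine (ENNReal.tendsto_ofReal h2).congr' ?_
  filter_upwards [h3] with m hm
  rw [ENNReal.ofReal_pow hm]
  push_cast
  rw [add_assoc]

lemma lintegral_ofReal_add_const_sub [IsProbabilityMeasure μ] {Y Z : Ω → ℝ} (hY : Integrable Y μ)
    (hZ : Integrable Z μ) {ε K : ℝ} (h : ∀ ω, 0 ≤ ε * Z ω + K - Y ω) :
    ∫⁻ ω, ENNReal.ofReal (ε * Z ω + K - Y ω) ∂μ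
      = ENNReal.ofReal (ε * ∫ ω, Z ω ∂μ + K - ∫ ω, Y ω ∂μ) := by
  have h1 : Integrable (fun ω => ε * Z ω + K) μ := (hZ.const_mul ε).add (integrable_const K)
  rw [← ofReal_integral_eq_lintegral_ofReal (f := fun ω => ε * Z ω + K - Y ω) (h1.sub hY)
    (ae_of_all _ h), integral_sub h1 hY, integral_add (hZ.const_mul ε) (integrable_const K),
    integral_const_mul]
  simp

namespace IsGeometricBrownianMotionSL

variable (hF : IsGeometricBrownianMotionSL μ ℱ B F) [IsProbabilityMeasure μ]
  (hq : HasCovarianceForm μ B q)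
include hF hq

/-- The error of the Euler scheme is of order `δ` in second moment. It solves the Euler recursion
up to the error of the Riemann sums of `F`, so a discrete Grönwall argument applies. -/
lemma secondMoment_sub_euler (T : ℝ) (δ : ℝ≥0) (n : ℕ) (hn : (grid δ n : ℝ) ≤ T) (i j : Fin 2) :
    SecondMomentLE μ (fun ω => F (grid δ n) ω i j - euler B (grid δ) n ω i j)
      (2 * (isometryConst q * (isometryConst q * Real.exp T * δ) * T) *
        (1 + 2 * isometryConst q * δ) ^ n) := by
  set K := isometryConst q with hK
  have hK0 : 0 ≤ K := isometryConst_nonneg q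
  set r := K * (K * Real.exp T * δ) * T with hr
  induction n using Nat.strong_induction_on generalizing i j with
  | _ n ih =>
    have hrem := secondMoment_remainder hF hq (T := T) δ 0 n (by rwa [zero_add]) i j
    simp only [zero_add] at hrem
    have hg0 : grid δ 0 = 0 := by simp [grid]
    rw [hg0] at hrem
    have hm := measurable_euler hF.driver (grid_mono δ)
    have hL := memLp_euler hF.driver hq (grid_mono δ)
    have hS := (sum_mul_incr hF.driver hq (grid_mono δ)
      (H := fun k ω => F (grid δ k) ω - euler B (grid δ) k ω)
      (fun k i j => (hF.adapted _ i j).sub (hm k i j))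
      (fun k i j => (secondMoment_entry hF _ i j).1.sub (hL k i j))
      (g := fun k => 2 * r * (1 + 2 * K * δ) ^ k) n (fun k hk i j => ih k hk (by
        refine le_trans ?_ hn
        exact_mod_cast grid_mono δ hk.le) i j) i j).1
    have hrem' := hrem.mono (b := r) (by
      rw [hr]
      refine mul_le_mul_of_nonneg_left ?_ (by positivity)
      refine le_trans (le_of_eq ?_) hn
      simp [grid])
    refine ((hrem'.add hS).mono (le_of_eq ?_)).congr ?_
    · simp only [grid_succ_sub]
      have hgeom := mul_geom_sum (1 + 2 * K * (δ : ℝ)) n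
      rw [add_sub_cancel_left] at hgeom
      rw [← hK]
      have : K * ∑ k ∈ Finset.range n, 2 * r * (1 + 2 * K * (δ : ℝ)) ^ k * δ
          = r * ((2 * K * δ) * ∑ k ∈ Finset.range n, (1 + 2 * K * (δ : ℝ)) ^ k) := by
        rw [Finset.mul_sum, Finset.mul_sum, Finset.mul_sum]
        exact Finset.sum_congr rfl fun k _ => by ring
      rw [this, hgeom]
      ring
    · filter_upwards [hF.initial] with ω hω
      rw [euler_eq_sum (B := B) (grid δ) n ω, hω]
      simp only [sub_mul, Finset.sum_sub_distrib, Matrix.sub_apply, Matrix.add_apply]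
      ring

lemma tendstoInMeasure_euler (t : ℝ≥0) (i j : Fin 2) :
    TendstoInMeasure μ (fun (m : ℕ) ω => euler B (grid (t / (m : ℝ≥0))) m ω i j) atTop
      (fun ω => F t ω i j) := by
  set K := isometryConst q with hK
  have hK0 : 0 ≤ K := isometryConst_nonneg q
  refine SecondMomentLE.tendstoInMeasure
    (c := fun m : ℕ => 2 * (K * (K * Real.exp t * t) * t) * Real.exp (2 * K * t) * (1 / (m : ℝ)))
    ?_ ?_
  · simpa using (tendsto_one_div_atTop_nhds_zero_nat (𝕜 := ℝ)).const_mul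
      (2 * (K * (K * Real.exp t * t) * t) * Real.exp (2 * K * t))
  · filter_upwards [eventually_ne_atTop 0] with m hm
    have hm' : (m : ℝ) ≠ 0 := by exact_mod_cast hm
    have hgt : grid (t / (m : ℝ≥0)) m = t := by
      have := grid_div_mul t hm 1
      simpa [grid] using this
    have h1 := (secondMoment_sub_euler hF hq t (t / (m : ℝ≥0)) m (by rw [hgt]) i j).neg
    rw [hgt] at h1
    refine (h1.mono ?_).congr (ae_of_all _ fun ω => by simp)
    have h2 : (1 + 2 * K * ((t / (m : ℝ≥0) : ℝ≥0) : ℝ)) ^ m ≤ Real.exp (2 * K * t) := by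
      have h3 : 1 + 2 * K * ((t / (m : ℝ≥0) : ℝ≥0) : ℝ)
          ≤ Real.exp (2 * K * ((t / (m : ℝ≥0) : ℝ≥0) : ℝ)) := by
        rw [add_comm]; exact Real.add_one_le_exp _
      refine (pow_le_pow_left₀ (by positivity) h3 m).trans (le_of_eq ?_)
      rw [← Real.exp_nat_mul]
      push_cast
      congr 1
      field_simp
    calc _ ≤ 2 * (K * (K * Real.exp t * (t / (m : ℝ≥0) : ℝ≥0)) * t) * Real.exp (2 * K * t) := by
          rw [← hK]; gcongr
      _ = _ := by push_cast; ring

variable (hiso : IsIsotropic q)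
include hiso

lemma lintegral_row_rpow_le {p : ℝ} (hp : 1 ≤ p) (t : ℝ≥0) (i : Fin 2) :
    ∫⁻ ω, ENNReal.ofReal ((F t ω i 0 ^ 2 + F t ω i 1 ^ 2) ^ p) ∂μ ≤
      ENNReal.ofReal (Real.exp (p * (p + 1) / 2 * t)) := by
  obtain ⟨C, hC, h⟩ := exists_lintegral_euler_row hF.driver hq hiso hp
  have hm : ∀ (m : ℕ) (j : Fin 2),
      Measurable (fun ω => euler B (grid (t / (m : ℝ≥0))) m ω i j) := fun m j =>
    (measurable_euler hF.driver (grid_mono _) m i j).mono (ℱ.le _) le_rfl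
  refine lintegral_le_of_tendstoInMeasure (tendstoInMeasure_euler hF hq t i 0)
    (tendstoInMeasure_euler hF hq t i 1) (fun m => hm m 0) (fun m => hm m 1)
    (g := fun z => (z.1 ^ 2 + z.2 ^ 2) ^ p) ?_ (tendsto_growth _ C t) ?_
  · exact Continuous.rpow_const (by fun_prop) fun _ => Or.inr (by linarith)
  · obtain ⟨N, hN⟩ := exists_nat_gt t
    filter_upwards [eventually_ge_atTop (N + 1)] with m hmN
    refine (h _ ?_ i m).1
    have hmpos : (0 : ℝ≥0) < m := by exact_mod_cast (by omega : 0 < m)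
    rw [div_le_one hmpos]
    exact hN.le.trans (by exact_mod_cast (by omega : N ≤ m))

lemma integrable_row_rpow {p : ℝ} (hp : 1 ≤ p) (t : ℝ≥0) (i : Fin 2) :
    Integrable (fun ω => (F t ω i 0 ^ 2 + F t ω i 1 ^ 2) ^ p) μ := by
  have h0 := measurable_entry hF t i 0
  have h1 := measurable_entry hF t i 1
  rw [← lintegral_ofReal_ne_top_iff_integrable (by
    exact Measurable.aestronglyMeasurable (by fun_prop)) (ae_of_all _ fun ω => by positivity)]
  exact ((lintegral_row_rpow_le hF hq hiso hp t i).trans_lt ENNReal.ofReal_lt_top).ne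

lemma integral_row_rpow_le {p : ℝ} (hp : 1 ≤ p) (t : ℝ≥0) (i : Fin 2) :
    ∫ ω, (F t ω i 0 ^ 2 + F t ω i 1 ^ 2) ^ p ∂μ ≤ Real.exp (p * (p + 1) / 2 * t) := by
  have h := lintegral_row_rpow_le hF hq hiso hp t i
  rw [← ofReal_integral_eq_lintegral_ofReal (integrable_row_rpow hF hq hiso hp t i)
    (ae_of_all _ fun ω => by positivity)] at h
  exact (ENNReal.ofReal_le_ofReal_iff (Real.exp_pos _).le).1 h

/-- No mass is lost in the limit of the `p`-th moments, because the `2p`-th moments are bounded.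
Instead of uniform integrability, Fatou's lemma is applied to `ε x^{2p} + 1 / (4ε) - x^p ≥ 0`. -/
lemma le_integral_row_rpow {p : ℝ} (hp : 1 ≤ p) (t : ℝ≥0) (i : Fin 2) :
    Real.exp (p * (p + 1) / 2 * t) ≤ ∫ ω, (F t ω i 0 ^ 2 + F t ω i 1 ^ 2) ^ p ∂μ := by
  have h2p : 1 ≤ 2 * p := by linarith
  obtain ⟨C₁, hC₁, h1⟩ := exists_lintegral_euler_row hF.driver hq hiso hp
  obtain ⟨C₂, hC₂, h2⟩ := exists_lintegral_euler_row hF.driver hq hiso h2p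
  set L := Real.exp (2 * p * (2 * p + 1) / 2 * t) with hL
  have hm : ∀ (m : ℕ) (j : Fin 2),
      Measurable (fun ω => euler B (grid (t / (m : ℝ≥0))) m ω i j) := fun m j =>
    (measurable_euler hF.driver (grid_mono _) m i j).mono (ℱ.le _) le_rfl
  have hsq : ∀ x : ℝ, 0 ≤ x → x ^ (2 * p) = (x ^ p) ^ 2 := fun x hx => by
    rw [mul_comm, Real.rpow_mul hx, Real.rpow_two]
  have key : ∀ ε : ℝ, 0 < ε → Real.exp (p * (p + 1) / 2 * t) - ε * L ≤
      ∫ ω, (F t ω i 0 ^ 2 + F t ω i 1 ^ 2) ^ p ∂μ := by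
    intro ε hε
    set K : ℝ := 1 / (4 * ε) with hK
    -- `ε y² + 1 / (4ε) - y` is a square.
    have hpos : ∀ x : ℝ, 0 ≤ x → 0 ≤ ε * x ^ (2 * p) + K - x ^ p := by
      intro x hx
      rw [hsq x hx, hK]
      have : ε * (x ^ p) ^ 2 + 1 / (4 * ε) - x ^ p = ε * (x ^ p - 1 / (2 * ε)) ^ 2 := by
        field_simp; ring
      rw [this]; positivity
    have hup := tendsto_growth (2 * p * (2 * p + 1) / 2) C₂ t
    have hlo := tendsto_growth (p * (p + 1) / 2) (-C₁) t
    have hup' := (ENNReal.tendsto_toReal ENNReal.ofReal_ne_top).comp hup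
    have hlo' := (ENNReal.tendsto_toReal ENNReal.ofReal_ne_top).comp hlo
    rw [ENNReal.toReal_ofReal (Real.exp_pos _).le] at hup' hlo'
    have hc := ENNReal.tendsto_ofReal (((hup'.const_mul ε).add_const K).sub hlo')
    have hfat := lintegral_le_of_tendstoInMeasure (tendstoInMeasure_euler hF hq t i 0)
      (tendstoInMeasure_euler hF hq t i 1) (fun m => hm m 0) (fun m => hm m 1)
      (g := fun z => ε * (z.1 ^ 2 + z.2 ^ 2) ^ (2 * p) + K - (z.1 ^ 2 + z.2 ^ 2) ^ p)
      (by
        have hcont : Continuous fun z : ℝ × ℝ => z.1 ^ 2 + z.2 ^ 2 := by fun_prop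
        exact ((continuous_const.mul (hcont.rpow_const fun _ => Or.inr (by linarith))).add
          continuous_const).sub (hcont.rpow_const fun _ => Or.inr (by linarith)))
      hc (by
        obtain ⟨N, hN⟩ := exists_nat_gt t
        filter_upwards [eventually_ge_atTop (N + 1)] with m hmN
        have hδ : t / (m : ℝ≥0) ≤ 1 := by
          have hmpos : (0 : ℝ≥0) < m := by exact_mod_cast (by omega : 0 < m)
          rw [div_le_one hmpos]
          exact hN.le.trans (by exact_mod_cast (by omega : N ≤ m))
        have u1 := h1 _ hδ i m
        have u2 := h2 _ hδ i m
        have hm0 := hm m 0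
        have hm1 := hm m 1
        have i1 : Integrable (fun ω => (euler B (grid (t / (m : ℝ≥0))) m ω i 0 ^ 2
            + euler B (grid (t / (m : ℝ≥0))) m ω i 1 ^ 2) ^ p) μ := by
          rw [← lintegral_ofReal_ne_top_iff_integrable (by
            exact Measurable.aestronglyMeasurable (by fun_prop))
            (ae_of_all _ fun ω => by positivity)]
          exact (u1.1.trans_lt (ENNReal.pow_lt_top ENNReal.ofReal_lt_top)).ne
        have i2 : Integrable (fun ω => (euler B (grid (t / (m : ℝ≥0))) m ω i 0 ^ 2
            + euler B (grid (t / (m : ℝ≥0))) m ω i 1 ^ 2) ^ (2 * p)) μ := by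
          rw [← lintegral_ofReal_ne_top_iff_integrable (by
            exact Measurable.aestronglyMeasurable (by fun_prop))
            (ae_of_all _ fun ω => by positivity)]
          exact (u2.1.trans_lt (ENNReal.pow_lt_top ENNReal.ofReal_lt_top)).ne
        refine (lintegral_ofReal_add_const_sub i1 i2 fun ω => hpos _ (by positivity)).le.trans
          (ENNReal.ofReal_le_ofReal ?_)
        rw [← ofReal_integral_eq_lintegral_ofReal i2 (ae_of_all _ fun ω => by positivity)] at u2
        rw [← ofReal_integral_eq_lintegral_ofReal i1 (ae_of_all _ fun ω => by positivity)] at u1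
        have v2 := ENNReal.toReal_mono (ENNReal.pow_lt_top ENNReal.ofReal_lt_top).ne u2.1
        have v1 := ENNReal.toReal_mono ENNReal.ofReal_ne_top u1.2
        rw [ENNReal.toReal_ofReal (integral_nonneg fun ω => by positivity)] at v1 v2
        simp only [Function.comp, neg_mul, ← sub_eq_add_neg]
        have v3 := mul_le_mul_of_nonneg_left v2 hε.le
        linarith)
    have j1 := integrable_row_rpow hF hq hiso hp t i
    have j2 := integrable_row_rpow hF hq hiso h2p t i
    rw [lintegral_ofReal_add_const_sub j1 j2 fun ω => hpos _ (by positivity)] at hfat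
    have hnn : 0 ≤ ∫ ω, (F t ω i 0 ^ 2 + F t ω i 1 ^ 2) ^ (2 * p) ∂μ :=
      integral_nonneg fun ω => by positivity
    have hnonneg : 0 ≤ ε * L + K - Real.exp (p * (p + 1) / 2 * t) := by
      have hq1 : Real.exp (p * (p + 1) / 2 * t) ^ 2 ≤ L := by
        rw [hL, ← Real.exp_nat_mul]
        refine Real.exp_le_exp.2 ?_
        have : (0 : ℝ) ≤ t := t.2
        push_cast
        nlinarith [mul_nonneg (mul_nonneg (by linarith : 0 ≤ p) (by linarith : 0 ≤ p)) this]
      have : ε * Real.exp (p * (p + 1) / 2 * t) ^ 2 + K - Real.exp (p * (p + 1) / 2 * t)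
          = ε * (Real.exp (p * (p + 1) / 2 * t) - 1 / (2 * ε)) ^ 2 := by
        rw [hK]; field_simp; ring
      have h3 : 0 ≤ ε * (Real.exp (p * (p + 1) / 2 * t) - 1 / (2 * ε)) ^ 2 := by positivity
      have h4 := mul_le_mul_of_nonneg_left hq1 hε.le
      linarith
    have hfin := (ENNReal.ofReal_le_ofReal_iff hnonneg).1 hfat
    nlinarith [mul_nonneg hε.le hnn]
  have hlim : Tendsto (fun n : ℕ => Real.exp (p * (p + 1) / 2 * t) - (1 / ((n : ℝ) + 1)) * L) atTop
      (𝓝 (Real.exp (p * (p + 1) / 2 * t) - 0 * L)) :=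
    tendsto_const_nhds.sub (tendsto_one_div_add_atTop_nhds_zero_nat.mul_const L)
  rw [zero_mul, sub_zero] at hlim
  exact le_of_tendsto' hlim fun n => key _ (by positivity)

end IsGeometricBrownianMotionSL

lemma frobeniusNorm_rpow (A : Matrix (Fin 2) (Fin 2) ℝ) (p : ℝ) :
    frobeniusNorm A ^ (2 * p) =
      ((A 0 0 ^ 2 + A 0 1 ^ 2) + (A 1 0 ^ 2 + A 1 1 ^ 2)) ^ p := by
  have h : (A * Aᵀ).trace = (A 0 0 ^ 2 + A 0 1 ^ 2) + (A 1 0 ^ 2 + A 1 1 ^ 2) := by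
    simp [Matrix.trace_fin_two, Matrix.mul_apply, Fin.sum_univ_two, sq]
  unfold frobeniusNorm
  rw [Real.rpow_mul (Real.sqrt_nonneg _), Real.rpow_two, h, Real.sq_sqrt (by positivity)]

end

end GBM

/-- The moments of the geometric Brownian motion on `SL(2)`:
`𝔼 |F_τ|^{2p} ∼_p exp (½ p (p + 1) τ)` for all `p ≥ 1` and `τ ≥ 0`. -/
theorem lemma3 (p : ℝ) (hp : 1 ≤ p) :
    ∃ c C : ℝ, 0 < c ∧ 0 < C ∧
      ∀ (Ω : Type*) [mΩ : MeasurableSpace Ω] (μ : Measure Ω) [IsProbabilityMeasure μ]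
        (ℱ : Filtration ℝ≥0 mΩ) (B F : ℝ≥0 → Ω → Matrix (Fin 2) (Fin 2) ℝ),
        IsGeometricBrownianMotionSL μ ℱ B F →
        ∀ τ : ℝ≥0,
          Integrable (fun ω => frobeniusNorm (F τ ω) ^ (2 * p)) μ ∧
          c * Real.exp (1 / 2 * p * (p + 1) * τ) ≤
            ∫ ω, frobeniusNorm (F τ ω) ^ (2 * p) ∂μ ∧
          ∫ ω, frobeniusNorm (F τ ω) ^ (2 * p) ∂μ ≤
            C * Real.exp (1 / 2 * p * (p + 1) * τ) := by
  refine ⟨1, 2 ^ p * 2, one_pos, by positivity, ?_⟩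
  intro Ω mΩ μ _ ℱ B F hF τ
  obtain ⟨q, hq⟩ := hF.driver.gaussian
  have hiso : GBM.IsIsotropic q := GBM.IsGeometricBrownianMotionSL.covariance_eq hF hq
  have hp0 : 0 ≤ p := by linarith
  have hi := fun i => GBM.IsGeometricBrownianMotionSL.integrable_row_rpow hF hq hiso hp τ i
  have hup := fun i => GBM.IsGeometricBrownianMotionSL.integral_row_rpow_le hF hq hiso hp τ i
  have hlo := GBM.IsGeometricBrownianMotionSL.le_integral_row_rpow hF hq hiso hp τ 0
  have hm := GBM.IsGeometricBrownianMotionSL.measurable_entry hF τ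
  have hexp : Real.exp (1 / 2 * p * (p + 1) * τ) = Real.exp (p * (p + 1) / 2 * τ) := by
    congr 1; ring
  have hle : ∀ x y : ℝ, 0 ≤ x → 0 ≤ y → (x + y) ^ p ≤ 2 ^ p * (x ^ p + y ^ p) := by
    have key : ∀ x y : ℝ, 0 ≤ x → x ≤ y → (x + y) ^ p ≤ 2 ^ p * (x ^ p + y ^ p) := by
      intro x y hx hxy
      have hy := hx.trans hxy
      calc (x + y) ^ p ≤ (2 * y) ^ p := Real.rpow_le_rpow (by positivity) (by linarith) hp0
        _ = 2 ^ p * y ^ p := Real.mul_rpow zero_le_two hy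
        _ ≤ 2 ^ p * (x ^ p + y ^ p) := by
          gcongr; linarith [Real.rpow_nonneg hx p]
    intro x y hx hy
    rcases le_total x y with h | h
    · exact key x y hx h
    · rw [add_comm x y, add_comm (x ^ p)]; exact key y x hy h
  simp only [GBM.frobeniusNorm_rpow, hexp]
  have hsum : Integrable (fun ω => 2 ^ p * ((F τ ω 0 0 ^ 2 + F τ ω 0 1 ^ 2) ^ p +
      (F τ ω 1 0 ^ 2 + F τ ω 1 1 ^ 2) ^ p)) μ := ((hi 0).add (hi 1)).const_mul _
  have hpt : ∀ ω, (F τ ω 0 0 ^ 2 + F τ ω 0 1 ^ 2 + (F τ ω 1 0 ^ 2 + F τ ω 1 1 ^ 2)) ^ p ≤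
      2 ^ p * ((F τ ω 0 0 ^ 2 + F τ ω 0 1 ^ 2) ^ p + (F τ ω 1 0 ^ 2 + F τ ω 1 1 ^ 2) ^ p) :=
    fun ω => hle _ _ (by positivity) (by positivity)
  have hint : Integrable (fun ω => (F τ ω 0 0 ^ 2 + F τ ω 0 1 ^ 2 +
      (F τ ω 1 0 ^ 2 + F τ ω 1 1 ^ 2)) ^ p) μ := by
    refine hsum.mono' ?_ (ae_of_all _ fun ω => ?_)
    · have h00 := hm 0 0
      have h01 := hm 0 1
      have h10 := hm 1 0
      have h11 := hm 1 1
      exact Measurable.aestronglyMeasurable (by fun_prop)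
    · rw [Real.norm_eq_abs, abs_of_nonneg (by positivity)]
      exact hpt ω
  refine ⟨hint, ?_, ?_⟩
  · rw [one_mul]
    refine hlo.trans (integral_mono (hi 0) hint fun ω => ?_)
    refine Real.rpow_le_rpow (by positivity) ?_ hp0
    have : 0 ≤ F τ ω 1 0 ^ 2 + F τ ω 1 1 ^ 2 := by positivity
    linarith
  · refine (integral_mono hint hsum hpt).trans ?_
    rw [integral_const_mul, integral_add (hi 0) (hi 1), mul_assoc]
    refine mul_le_mul_of_nonneg_left ?_ (by positivity)
    linarith [hup 0, hup 1]
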